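/- Let $k$ be an algebraically closed field of characteristic $p\neq 2$ and let $i\in k$ with $i^2=-1$. Let $\mathfrak G$ be the Humbert cubic line complex, that is, the set of all lines in $\mathbb P^3$ that are contained in some quadric of the net $$t_1(xy+zw)+t_2(xz+yw)+t_3(xw+yz)=0,\qquad (t_1,t_2,t_3)\neq(0,0,0).$$ Regard $\mathfrak G$ as a subvariety (of dimension $3$) of $\mathbb P^5$ by means of the Klein coordinates $$(x_1,x_2,x_3,y_1,y_2,y_3)=\bigl(p_{12}+p_{34},\,-p_{13}+p_{24},\,p_{14}+p_{23},\,i(p_{34}-p_{12}),\,i(p_{24}+p_{13}),\,i(p_{23}-p_{14})\bigr),$$ where $p_{rs}=a_rb_s-a_sb_r$ are the Plücker coordinates of the line joining $a$ and $b$. Let $G\subset \mathrm{PGL}_6(k)$ be the group of projective automorphisms of $\mathfrak G$, i.e. the group of projective transformations of $\mathbb P^5$ that map $\mathfrak G$ onto itself. Then: 1. $G\cong(\mathfrak S_4\times\mathfrak S_4)\rtimes 2$, where the generator of the group of order $2$ interchanges the two factors. The isomorphism can be chosen so that $\mathfrak S_4\times\mathfrak S_4$ corresponds to the group of the transformations that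 permute $x_1,x_2,x_3$ with an even number of sign changes and permute $y_1,y_2,y_3$ with an even number of sign changes, and so that the additional generator corresponds to the projective transformation of order $2$ $$g_0:(x_1,x_2,x_3,y_1,y_2,y_3)\mapsto(-y_1,-y_2,-y_3,x_1,x_2,x_3).$$ 2. The set of singular points of $\mathfrak G$ is the disjoint union $\mathrm{Sing}(\mathfrak G)_1\cup\mathrm{Sing}(\mathfrak G)_2$. Here $\mathrm{Sing}(\mathfrak G)_1$ consists of the $18$ points with one $x_j$ equal to $1$, one $y_l$ equal to $\pm i$ and all other coordinates equal to $0$, and $\mathrm{Sing}(\mathfrak G)_2$ consists of the $16$ points $[\epsilon_1,\epsilon_2,\epsilon_3,e_1,e_2,e_3]$ with $\epsilon_j^2=-1$, $e_j^2=1$ and $\epsilon_1\epsilon_2\epsilon_3+i\,e_1e_2e_3=0$. These two sets are the orbits of $G$ on the $34$ singular points of $\mathfrak G$. 3. $\mathfrak G$ contains exactly $24$ planes of $\mathbb P^5$, and $G$ acts transitively on them. -/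

import Mathlib

open scoped LinearAlgebra.Projectivization MatrixGroups Pointwise

namespace Desmic

/-! ### Projective varieties over a field, via their points -/

section Projective

variable {k ι : Type*} [Field k]

/-- `f` vanishes on the set `X` of points of the projective space with coordinates indexed by `ι`
(`f` is evaluated at every coordinate vector of every point of `X`). -/
def VanishesOn (f : MvPolynomial ι k) (X : Set (ℙ k (ι → k))) : Prop :=
  ∀ (v : ι → k) (hv : v ≠ 0), Projectivization.mk k v hv ∈ X → MvPolynomial.eval v f = 0

/-- The tangent space at the point `P` of the affine cone over `X`: the common kernel of the
differentials at `P` of all homogeneous forms vanishing on `X`. Its dimension is one more than the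
dimension of the embedded projective tangent space of `X` at `P`. -/
def coneTangentSpace [Fintype ι] (X : Set (ℙ k (ι → k))) (P : ℙ k (ι → k)) :
    Submodule k (ι → k) where
  carrier := {w | ∀ (d : ℕ) (f : MvPolynomial ι k), f.IsHomogeneous d → VanishesOn f X →
    ∑ j, MvPolynomial.eval P.rep (MvPolynomial.pderiv j f) * w j = 0}
  zero_mem' := by
    intro d f _ _
    simp
  add_mem' := by
    intro a b ha hb d f hf hX
    simp only [Pi.add_apply, mul_add, Finset.sum_add_distrib, ha d f hf hX, hb d f hf hX, add_zero]
  smul_mem' := by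
    intro c a ha d f hf hX
    simp only [Pi.smul_apply, smul_eq_mul, mul_left_comm _ c, ← Finset.mul_sum, ha d f hf hX,
      mul_zero]

/-- The singular points of a projective variety `X` of pure dimension `n`: the points at which the
projective tangent space has dimension larger than `n`. -/
def singularPoints [Fintype ι] (n : ℕ) (X : Set (ℙ k (ι → k))) : Set (ℙ k (ι → k)) :=
  {P | P ∈ X ∧ n + 1 < Module.finrank k (coneTangentSpace X P)}

/-- The set of (projective) planes contained in `X`, a plane being viewed as a set of points. -/
def planesIn (X : Set (ℙ k (ι → k))) : Set (Set (ℙ k (ι → k))) :=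
  {E | E ⊆ X ∧ ∃ W : Submodule k (ι → k), Module.finrank k W = 3 ∧ E = {P | P.submodule ≤ W}}

/-- The group of projective automorphisms of `X`: the projective transformations that map `X` onto
itself. -/
abbrev projectiveAut [Fintype ι] [DecidableEq ι] (X : Set (ℙ k (ι → k))) : Subgroup PGL(ι, k) :=
  MulAction.stabilizer PGL(ι, k) X

end Projective

/-! ### The Humbert line complex -/

section Humbert

variable {k : Type*} [Field k]

/-- The index set of the Klein coordinates `(x₁, x₂, x₃, y₁, y₂, y₃)`; the coordinate vector is
`Sum.elim x y`. -/
abbrev KIdx : Type := Fin 3 ⊕ Fin 3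

/-- The quadrics `t₁(xy + zw) + t₂(xz + yw) + t₃(xw + yz) = 0` of the net of quadrics through the
eight vertices of two of the three tetrahedra of a desmic triple. -/
def netQuadric (t : Fin 3 → k) (v : Fin 4 → k) : k :=
  t 0 * (v 0 * v 1 + v 2 * v 3) + t 1 * (v 0 * v 2 + v 1 * v 3) + t 2 * (v 0 * v 3 + v 1 * v 2)

/-- The Plücker coordinates `p_{rs}` of the line in `ℙ³` joining the points `a` and `b`. -/
def plucker (a b : Fin 4 → k) (r s : Fin 4) : k := a r * b s - a s * b r

/-- The Klein coordinates of the line in `ℙ³` joining `a` and `b`; here `i` is a square root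
of `-1`. -/
def klein (i : k) (a b : Fin 4 → k) : KIdx → k :=
  Sum.elim
    ![plucker a b 0 1 + plucker a b 2 3,
      -plucker a b 0 2 + plucker a b 1 3,
      plucker a b 0 3 + plucker a b 1 2]
    ![i * (plucker a b 2 3 - plucker a b 0 1),
      i * (plucker a b 1 3 + plucker a b 0 2),
      i * (plucker a b 1 2 - plucker a b 0 3)]

/-- The Humbert cubic line complex in Klein coordinates: the set of all lines `⟨a, b⟩` of `ℙ³`
that are contained in some quadric of the net. -/
def humbertComplex (i : k) : Set (ℙ k (KIdx → k)) :=
  {P | ∃ a b : Fin 4 → k, LinearIndependent k ![a, b] ∧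
    (∃ t : Fin 3 → k, t ≠ 0 ∧ ∀ r s : k, netQuadric t (r • a + s • b) = 0) ∧
    P.submodule = Submodule.span k {klein i a b}}

/-- The points `[1,0,0,±i,0,0], …, [0,0,1,0,0,±i]`: one of the `xⱼ` is `1`, one of the `yₗ` is a
square root of `-1`, all other coordinates are `0`. -/
def sing₁ (k : Type*) [Field k] : Set (ℙ k (KIdx → k)) :=
  {P | ∃ (j l : Fin 3) (c : k), c ^ 2 = -1 ∧
    P.submodule = Submodule.span k {Sum.elim (Pi.single j (1 : k)) (Pi.single l c)}}

/-- The points `[ε₁,ε₂,ε₃,e₁,e₂,e₃]` with `εⱼ² = -1`, `eⱼ² = 1` and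
`ε₁ε₂ε₃ + i e₁e₂e₃ = 0`. -/
def sing₂ (i : k) : Set (ℙ k (KIdx → k)) :=
  {P | ∃ ε e : Fin 3 → k, (∀ j, ε j ^ 2 = -1) ∧ (∀ j, e j ^ 2 = 1) ∧
    ε 0 * ε 1 * ε 2 + i * (e 0 * e 1 * e 2) = 0 ∧
    P.submodule = Submodule.span k {Sum.elim ε e}}

/-- The linear transformation `(x, y) ↦ (-y, x)`. -/
def g₀ (k : Type*) [Field k] : GL KIdx k where
  val := Matrix.fromBlocks 0 (-1) 1 0
  inv := Matrix.fromBlocks 0 1 (-1) 0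
  val_inv := by simp [Matrix.fromBlocks_multiply]
  inv_val := by simp [Matrix.fromBlocks_multiply]

theorem g₀_smul (x y : Fin 3 → k) : g₀ k • (Sum.elim x y : KIdx → k) = Sum.elim (-y) x := by
  change Matrix.mulVec (Matrix.fromBlocks 0 (-1) 1 0) (Sum.elim x y) = _
  simp [Matrix.fromBlocks_mulVec, Matrix.neg_mulVec]

/-- The obvious projective symmetries in Klein coordinates: permutations of the `xⱼ` with an even
number of sign changes, combined with permutations of the `yⱼ` with an even number of sign
changes. -/
def obviousSymmetries (k : Type*) [Field k] : Set PGL(KIdx, k) :=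
  {γ | ∃ (g : GL KIdx k) (σ τ : Equiv.Perm (Fin 3)) (ε e : Fin 3 → ℤˣ),
    ∏ j, ε j = 1 ∧ ∏ j, e j = 1 ∧
    (∀ x y : Fin 3 → k, g • (Sum.elim x y : KIdx → k) =
      Sum.elim (fun j => ((ε j : ℤ) : k) * x (σ j)) (fun j => ((e j : ℤ) : k) * y (τ j))) ∧
    γ = Matrix.ProjGenLinGroup.mk g}

end Humbert

/-- The action of the group of order two on `H × H` whose generator interchanges the factors. -/
def swapAction (H : Type*) [Group H] : Multiplicative (ZMod 2) →* MulAut (H × H) where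
  toFun z := if z = 1 then 1 else (MulEquiv.prodComm : H × H ≃* H × H)
  map_one' := by simp
  map_mul' := by
    have hsq : (MulEquiv.prodComm : H × H ≃* H × H) * (MulEquiv.prodComm : H × H ≃* H × H)
        = (1 : MulAut (H × H)) := by
      ext x <;> rfl
    have h : ∀ z : Multiplicative (ZMod 2), z = 1 ∨ z = Multiplicative.ofAdd 1 := by decide
    have h1 : (Multiplicative.ofAdd 1 : Multiplicative (ZMod 2)) ≠ 1 := by decide
    have h2 : (Multiplicative.ofAdd 1 * Multiplicative.ofAdd 1 : Multiplicative (ZMod 2)) = 1 := by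
      decide
    intro a b
    rcases h a with rfl | rfl <;> rcases h b with rfl | rfl
    · simp
    · rw [one_mul, if_pos rfl, one_mul]
    · rw [mul_one, if_pos rfl, mul_one]
    · rw [h2, if_pos rfl, if_neg h1]
      exact hsq.symm

end Desmic

namespace Desmic

/-! ### The tetrahedral representation of the symmetric group on four letters -/

section Tetrahedral

open Equiv

/-! Put z = i y. In the coordinates (x, z) the Plücker relation reads ∑ xⱼ² = ∑ zⱼ². A line lies on
a quadric of the net exactly when a 3 × 3 determinant vanishes, and this is the equation x₀x₁x₂ =
z₀z₁z₂ (`mk_mem_humbertComplex_iff`). Both equations compare one and the same invariant of x and of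
z. The symmetric group 𝔖₄, permuting the vertices v_a of a tetrahedron in k³, acts by signed
permutations with an even number of sign changes and preserves both invariants. Hence pairs (s, t)
in 𝔖₄ × 𝔖₄ and the exchange of x and z are symmetries, and the 24 graphs z = s x are planes of the
complex.

There are no other planes. A plane in the complex is maximal isotropic for the quadric, and on it
the cubic equation is an identity between two products of three linear forms. Unique factorization
matches the factors up to scalars, and the quadric forces these scalars to be signs
(`eq_graphPlane_of_humbertEqs`).

There are no other automorphisms. An automorphism permutes the 24 graphs, and after composition with
some (1, t) it preserves the diagonal, the graph of 1. The graph of s meets the diagonal in the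
fixed space of s, so the lines of the v_a are recognized as those lying on many graphs. The
automorphism therefore acts on the diagonal through 𝔖₄ up to a scalar
(`exists_tet_of_preserves_diag`). Once it is a scalar there, the induced permutation of the graphs
is almost determined, and only scalars and scalar multiples of the exchange remain
(`eq_smul_or_eq_smul_swap`).

At a singular point the gradients of the two equations are proportional, which leaves 34 points
(`cofactors_eq_smul_of_singular`). Conversely, the tangent space contains every plane of the complex
through the point, and at these points such planes span dimension at least 5
(`five_le_finrank_vertex`, `five_le_finrank_edge`), so generators of the ideal are never needed. The
34 points are the 16 pairs of vertices and the 18 pairs of edges of the tetrahedron (up to a common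
sign), on which transitivity is plain. -/

/-- The vertices of a regular tetrahedron, with integral coordinates. -/
def vertexSign : Fin 4 → Fin 3 → ℤ := ![![1, 1, 1], ![1, -1, -1], ![-1, 1, -1], ![-1, -1, 1]]

/-- The vertices of a regular tetrahedron, as vectors over a field. -/
def vertex (k : Type*) [Field k] (a : Fin 4) : Fin 3 → k := fun j => (vertexSign a j : k)

variable {k : Type*} [Field k]

theorem vertex_zero : vertex k 0 = ![1, 1, 1] := by
  ext j; fin_cases j <;> simp [vertex, vertexSign]

theorem vertex_one : vertex k 1 = ![1, -1, -1] := by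
  ext j; fin_cases j <;> simp [vertex, vertexSign]

theorem vertex_two : vertex k 2 = ![-1, 1, -1] := by
  ext j; fin_cases j <;> simp [vertex, vertexSign]

theorem vertex_three : vertex k 3 = ![-1, -1, 1] := by
  ext j; fin_cases j <;> simp [vertex, vertexSign]

theorem sum_vertex : ∑ a, vertex k a = 0 := by
  ext j
  fin_cases j <;> simp [Fin.sum_univ_four, vertex_zero, vertex_one, vertex_two, vertex_three]

theorem vertex_dotProduct (a b : Fin 4) :
    vertex k a ⬝ᵥ vertex k b = if a = b then 3 else -1 := by
  fin_cases a <;> fin_cases b <;>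
    simp [vertex_zero, vertex_one, vertex_two, vertex_three] <;> norm_num

/-- Tight frame property: the 4 × 3 matrix of the vertices has orthogonal columns of squared length
4. -/
theorem sum_dotProduct_smul_vertex (u : Fin 3 → k) :
    ∑ a, (vertex k a ⬝ᵥ u) • vertex k a = (4 : k) • u := by
  ext j
  fin_cases j <;>
    simp [Fin.sum_univ_four, vertex_zero, vertex_one, vertex_two, vertex_three, dotProduct,
      Fin.sum_univ_three] <;> ring

theorem sum_vertex_dotProduct (u : Fin 3 → k) : ∑ a, vertex k a ⬝ᵥ u = 0 := by
  rw [← sum_dotProduct, sum_vertex, zero_dotProduct]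

theorem vertex_ne_zero (a : Fin 4) : vertex k a ≠ 0 := by
  intro h
  have := congrFun h 0
  fin_cases a <;> simp [vertex_zero, vertex_one, vertex_two, vertex_three] at this

/-- The matrix of the linear transformation that permutes the vertices of the tetrahedron. -/
def tetMatrix (k : Type*) [Field k] (s : Perm (Fin 4)) : Matrix (Fin 3) (Fin 3) k :=
  Matrix.of fun j l => ∑ a, 4⁻¹ * (vertex k (s a) j * vertex k a l)

theorem tetMatrix_mulVec (s : Perm (Fin 4)) (u : Fin 3 → k) :
    (tetMatrix k s).mulVec u = ∑ a, ((4 : k)⁻¹ * (vertex k a ⬝ᵥ u)) • vertex k (s a) := by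
  ext j
  simp only [tetMatrix, Matrix.mulVec, dotProduct, Matrix.of_apply, Finset.sum_apply, Pi.smul_apply,
    smul_eq_mul, Finset.sum_mul, Finset.mul_sum]
  rw [Finset.sum_comm]
  refine Finset.sum_congr rfl fun a _ => Finset.sum_congr rfl fun l _ => by ring

variable [NeZero (2 : k)]

theorem four_ne_zero_of_two : (4 : k) ≠ 0 := by
  rw [show (4 : k) = 2 * 2 by norm_num]
  exact mul_ne_zero two_ne_zero two_ne_zero

theorem eq_sum_vertex (u : Fin 3 → k) :
    u = ∑ a, ((4 : k)⁻¹ * (vertex k a ⬝ᵥ u)) • vertex k a := by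
  simp_rw [mul_smul, ← Finset.smul_sum, sum_dotProduct_smul_vertex]
  rw [inv_smul_smul₀ four_ne_zero_of_two]

theorem linearMap_ext_vertex {M : Type*} [AddCommGroup M] [Module k M]
    {f g : (Fin 3 → k) →ₗ[k] M} (h : ∀ a, f (vertex k a) = g (vertex k a)) : f = g := by
  refine LinearMap.ext fun u => ?_
  rw [eq_sum_vertex (k := k) u]
  simp [h]

/-- Pairing with both vertices and eliminating c gives 8 = 0, an argument that also covers
characteristic 3. -/
theorem vertex_eq_smul {a b : Fin 4} {c : k} (h : vertex k a = c • vertex k b) : a = b := by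
  by_contra hab
  have h1 := congrArg (vertex k a ⬝ᵥ ·) h
  have h2 := congrArg (vertex k b ⬝ᵥ ·) h
  simp only [dotProduct_smul, vertex_dotProduct, if_true, if_neg hab, if_neg (Ne.symm hab),
    smul_eq_mul] at h1 h2
  have h3 : (2 : k) * 2 * 2 = 0 := by linear_combination 3 * h1 + h2
  simp [two_ne_zero] at h3

theorem vertex_injective : Function.Injective (vertex k) := fun a b h =>
  vertex_eq_smul (k := k) (c := 1) (by rw [h, one_smul])

theorem matrix_ext_vertex {M N : Matrix (Fin 3) (Fin 3) k}
    (h : ∀ a, M.mulVec (vertex k a) = N.mulVec (vertex k a)) : M = N :=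
  Matrix.toLin'.injective (linearMap_ext_vertex (by simpa using h))

theorem tetMatrix_mulVec_vertex (s : Perm (Fin 4)) (a : Fin 4) :
    (tetMatrix k s).mulVec (vertex k a) = vertex k (s a) := by
  -- The constant -1/4 in each coefficient drops out because the vertices sum to zero.
  have h : ∀ b, (4 : k)⁻¹ * (vertex k b ⬝ᵥ vertex k a) = (if b = a then 1 else 0) - 4⁻¹ := by
    intro b
    have := four_ne_zero_of_two (k := k)
    rw [vertex_dotProduct]
    split_ifs <;> field_simp <;> norm_num
  have h' : ∑ b, vertex k (s b) = 0 := by rw [Equiv.sum_comp s (vertex k), sum_vertex]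
  simp_rw [tetMatrix_mulVec, h, sub_smul, Finset.sum_sub_distrib, ← Finset.smul_sum, h']
  simp

/-- The tetrahedral representation of the symmetric group on four letters. -/
def tet (k : Type*) [Field k] [NeZero (2 : k)] : Perm (Fin 4) →* Matrix (Fin 3) (Fin 3) k where
  toFun := tetMatrix k
  map_one' := matrix_ext_vertex fun a => by simp [tetMatrix_mulVec_vertex]
  map_mul' s t := matrix_ext_vertex fun a => by
    simp [tetMatrix_mulVec_vertex, ← Matrix.mulVec_mulVec]

@[simp]
theorem tet_mulVec_vertex (s : Perm (Fin 4)) (a : Fin 4) :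
    (tet k s).mulVec (vertex k a) = vertex k (s a) := tetMatrix_mulVec_vertex s a

theorem tet_injective : Function.Injective (tet k) := by
  intro s t h
  ext1 a
  apply vertex_injective (k := k)
  rw [← tet_mulVec_vertex, h, tet_mulVec_vertex]

theorem tet_mulVec_mulVec (s t : Perm (Fin 4)) (u : Fin 3 → k) :
    (tet k s).mulVec ((tet k t).mulVec u) = (tet k (s * t)).mulVec u := by
  rw [Matrix.mulVec_mulVec, map_mul]

theorem tet_one_mulVec (u : Fin 3 → k) : (tet k 1).mulVec u = u := by simp

/-- The representation is orthogonal, since it permutes vectors whose Gram matrix is invariant under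
𝔖₄. -/
theorem vertex_dotProduct_tet (s : Perm (Fin 4)) (a : Fin 4) (u : Fin 3 → k) :
    vertex k (s a) ⬝ᵥ (tet k s).mulVec u = vertex k a ⬝ᵥ u := by
  have h4 := four_ne_zero_of_two (k := k)
  have h : ∀ b, 4⁻¹ * (vertex k b ⬝ᵥ u) * (if s a = s b then 3 else -1) =
      (if a = b then vertex k b ⬝ᵥ u else 0) - 4⁻¹ * (vertex k b ⬝ᵥ u) := by
    intro b
    simp only [s.injective.eq_iff]
    split_ifs <;> field_simp <;> ring
  change _ ⬝ᵥ (tetMatrix k s).mulVec u = _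
  simp_rw [tetMatrix_mulVec, dotProduct_sum, dotProduct_smul, vertex_dotProduct, smul_eq_mul, h,
    Finset.sum_sub_distrib, ← Finset.mul_sum, sum_vertex_dotProduct]
  simp

/-- For a vector fixed by s, the frame coefficients are constant on the cycles of s. -/
theorem vertex_dotProduct_eq_of_tet_eq {s : Perm (Fin 4)} {u : Fin 3 → k}
    (h : (tet k s).mulVec u = u) (n : ℕ) (a : Fin 4) :
    vertex k ((s ^ n) a) ⬝ᵥ u = vertex k a ⬝ᵥ u := by
  induction n with
  | zero => simp
  | succ n ih =>
    rw [pow_succ', Perm.mul_apply, ← ih, ← vertex_dotProduct_tet s ((s ^ n) a), h]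

/-- A signed permutation of the coordinates with an even number of sign changes permutes the
vertices of the tetrahedron. -/
theorem exists_vertexSign_of_signedPerm : ∀ (σ : Perm (Fin 3)) (ε : Fin 3 → ℤˣ), ∏ j, ε j = 1 →
    ∃ s : Perm (Fin 4), ∀ a j, (ε j : ℤ) * vertexSign a (σ j) = vertexSign (s a) j := by
  decide +kernel

/-- Converse of the preceding lemma: there are 3! · 4 = 24 such signed permutations, as many as
elements of 𝔖₄. -/
theorem exists_signedPerm_of_perm : ∀ s : Perm (Fin 4), ∃ (σ : Perm (Fin 3)) (ε : Fin 3 → ℤˣ),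
    ∏ j, ε j = 1 ∧ ∀ a j, (ε j : ℤ) * vertexSign a (σ j) = vertexSign (s a) j := by
  decide +kernel

theorem tet_mulVec_eq_iff (s : Perm (Fin 4)) (σ : Perm (Fin 3)) (ε : Fin 3 → ℤˣ)
    (h : ∀ a j, (ε j : ℤ) * vertexSign a (σ j) = vertexSign (s a) j) (u : Fin 3 → k) :
    (tet k s).mulVec u = fun j => ((ε j : ℤ) : k) * u (σ j) := by
  have : (tet k s).mulVecLin =
      LinearMap.pi fun j => ((ε j : ℤ) : k) • LinearMap.proj (σ j) := by
    apply linearMap_ext_vertex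
    intro a
    ext j
    simp only [Matrix.mulVecLin_apply, tet_mulVec_vertex, LinearMap.pi_apply, LinearMap.smul_apply,
      LinearMap.proj_apply, smul_eq_mul, vertex, ← h, Int.cast_mul]
  exact LinearMap.congr_fun this u

end Tetrahedral

/-! ### Equations of the Humbert complex -/

section Equations

variable {k : Type*} [Field k]

/-- The linear change of coordinates `(x, z) ↦ (x, y)` with `z = i y`. -/
def kvec {i : k} (hi : i ^ 2 = -1) : ((Fin 3 → k) × (Fin 3 → k)) ≃ₗ[k] (KIdx → k) where
  toFun p := Sum.elim p.1 (-i • p.2)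
  invFun v := (fun j => v (Sum.inl j), fun j => i * v (Sum.inr j))
  map_add' p q := by ext (j | j) <;> simp
  map_smul' c p := by ext (j | j) <;> simp [mul_left_comm]
  left_inv p := by
    ext j
    · simp
    · simp only [Sum.elim_inr, Pi.smul_apply, smul_eq_mul]
      linear_combination (-p.2 j) * hi
  right_inv v := by
    ext (j | j)
    · simp
    · simp only [Sum.elim_inr, Pi.smul_apply, smul_eq_mul]
      linear_combination (-v (Sum.inr j)) * hi

theorem kvec_apply {i : k} (hi : i ^ 2 = -1) (p : (Fin 3 → k) × (Fin 3 → k)) :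
    kvec hi p = Sum.elim p.1 (-i • p.2) := rfl

theorem kvec_inl {i : k} (hi : i ^ 2 = -1) (p : (Fin 3 → k) × (Fin 3 → k)) (j : Fin 3) :
    kvec hi p (Sum.inl j) = p.1 j := rfl

theorem kvec_inr {i : k} (hi : i ^ 2 = -1) (p : (Fin 3 → k) × (Fin 3 → k)) (j : Fin 3) :
    kvec hi p (Sum.inr j) = -i * p.2 j := rfl

theorem kvec_symm_fst {i : k} (hi : i ^ 2 = -1) (v : KIdx → k) (j : Fin 3) :
    ((kvec hi).symm v).1 j = v (Sum.inl j) := rfl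

theorem kvec_symm_snd {i : k} (hi : i ^ 2 = -1) (v : KIdx → k) (j : Fin 3) :
    ((kvec hi).symm v).2 j = i * v (Sum.inr j) := rfl

/-- The two equations of the Humbert complex in the coordinates `(x, z)`. -/
def HumbertEqs (p : (Fin 3 → k) × (Fin 3 → k)) : Prop :=
  p.1 0 ^ 2 + p.1 1 ^ 2 + p.1 2 ^ 2 = p.2 0 ^ 2 + p.2 1 ^ 2 + p.2 2 ^ 2 ∧
    p.1 0 * p.1 1 * p.1 2 = p.2 0 * p.2 1 * p.2 2

theorem HumbertEqs.smul {p : (Fin 3 → k) × (Fin 3 → k)} (h : HumbertEqs p) (c : k) :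
    HumbertEqs (c • p) := by
  obtain ⟨h1, h2⟩ := h
  constructor
  · simp only [Prod.smul_fst, Prod.smul_snd, Pi.smul_apply, smul_eq_mul]
    linear_combination c ^ 2 * h1
  · simp only [Prod.smul_fst, Prod.smul_snd, Pi.smul_apply, smul_eq_mul]
    linear_combination c ^ 3 * h2

/-- The matrix of the linear conditions on `t` for the line `⟨a, b⟩` to lie on the quadric of the
net with parameter `t`. -/
def netMatrix (a b : Fin 4 → k) : Matrix (Fin 3) (Fin 3) k :=
  !![a 0 * a 1 + a 2 * a 3, a 0 * a 2 + a 1 * a 3, a 0 * a 3 + a 1 * a 2;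
    a 0 * b 1 + a 1 * b 0 + (a 2 * b 3 + a 3 * b 2),
    a 0 * b 2 + a 2 * b 0 + (a 1 * b 3 + a 3 * b 1),
    a 0 * b 3 + a 3 * b 0 + (a 1 * b 2 + a 2 * b 1);
    b 0 * b 1 + b 2 * b 3, b 0 * b 2 + b 1 * b 3, b 0 * b 3 + b 1 * b 2]

theorem netQuadric_line (a b : Fin 4 → k) (t : Fin 3 → k) (r s : k) :
    netQuadric t (r • a + s • b) = r ^ 2 * (netMatrix a b).mulVec t 0 +
      r * s * (netMatrix a b).mulVec t 1 + s ^ 2 * (netMatrix a b).mulVec t 2 := by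
  simp [netQuadric, netMatrix, Matrix.mulVec, dotProduct, Fin.sum_univ_three]
  ring

theorem netMatrix_mulVec_eq_zero_iff (a b : Fin 4 → k) (t : Fin 3 → k) :
    (netMatrix a b).mulVec t = 0 ↔ ∀ r s : k, netQuadric t (r • a + s • b) = 0 := by
  simp only [netQuadric_line]
  constructor
  · intro h r s
    simp [h]
  · intro h
    -- A binary quadratic form is determined by its values at (1, 0), (0, 1) and (1, 1), in every
    -- characteristic.
    have h1 := h 1 0
    have h2 := h 0 1
    have h3 := h 1 1
    simp only [one_pow, one_mul, mul_zero, zero_mul, add_zero, ne_eq, OfNat.ofNat_ne_zero,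
      not_false_eq_true, zero_pow, zero_add, mul_one] at h1 h2 h3
    rw [h1, h2, zero_add, add_zero] at h3
    ext j
    fin_cases j
    · exact h1
    · exact h3
    · exact h2

/-- The difference of the two sides is 4 (p₁₂p₃₄ - p₁₃p₂₄ + p₁₄p₂₃). -/
theorem klein_symm_quadric {i : k} (hi : i ^ 2 = -1) (a b : Fin 4 → k) :
    let p := (kvec hi).symm (klein i a b)
    p.1 0 ^ 2 + p.1 1 ^ 2 + p.1 2 ^ 2 = p.2 0 ^ 2 + p.2 1 ^ 2 + p.2 2 ^ 2 := by
  have h4 : i ^ 4 = 1 := by linear_combination (i ^ 2 - 1) * hi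
  simp only [kvec_symm_fst, kvec_symm_snd, klein, Sum.elim_inl, Sum.elim_inr, Matrix.cons_val]
  ring_nf
  simp only [h4, plucker]
  ring

/-- The determinant is alternating under changes of basis of the line, so it is a cubic in the
Plücker coordinates; in Klein coordinates it becomes a difference of two monomials. -/
theorem klein_symm_cubic {i : k} (hi : i ^ 2 = -1) (a b : Fin 4 → k) :
    let p := (kvec hi).symm (klein i a b)
    p.1 0 * p.1 1 * p.1 2 - p.2 0 * p.2 1 * p.2 2 = -2 * (netMatrix a b).det := by
  have h6 : i ^ 6 = -1 := by linear_combination (i ^ 4 - i ^ 2 + 1) * hi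
  simp only [kvec_symm_fst, kvec_symm_snd, klein, Sum.elim_inl, Sum.elim_inr, Matrix.cons_val,
    Matrix.det_fin_three, netMatrix, Matrix.of_apply]
  ring_nf
  simp only [h6, plucker]
  ring

/-- Twice the matrix of Plücker coordinates in terms of the coordinates `(x, z)`. -/
def pluckerMatrix (x z : Fin 3 → k) : Matrix (Fin 4) (Fin 4) k :=
  !![0, x 0 + z 0, -(x 1 + z 1), x 2 + z 2;
    -(x 0 + z 0), 0, x 2 - z 2, x 1 - z 1;
    x 1 + z 1, -(x 2 - z 2), 0, x 0 - z 0;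
    -(x 2 + z 2), -(x 1 - z 1), -(x 0 - z 0), 0]

-- The hypothesis says that the Pfaffian of this skew matrix vanishes. The matrix then has rank at
-- most two, and its 2 × 2 minors factor, so two rows r, s with nonzero entry (r, s) span the line
-- with these Plücker coordinates.
set_option maxHeartbeats 1000000 in
theorem plucker_pluckerMatrix {x z : Fin 3 → k}
    (h : x 0 ^ 2 + x 1 ^ 2 + x 2 ^ 2 = z 0 ^ 2 + z 1 ^ 2 + z 2 ^ 2) (r s m n : Fin 4) :
    plucker (pluckerMatrix x z r) (pluckerMatrix x z s) m n =
      pluckerMatrix x z r s * pluckerMatrix x z m n := by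
  fin_cases r <;> fin_cases s <;> fin_cases m <;> fin_cases n <;>
    simp [plucker, pluckerMatrix] <;>
    first
    | done
    | ring1
    | linear_combination h
    | linear_combination -h

theorem klein_pluckerMatrix {i : k} (hi : i ^ 2 = -1) {x z : Fin 3 → k}
    (h : x 0 ^ 2 + x 1 ^ 2 + x 2 ^ 2 = z 0 ^ 2 + z 1 ^ 2 + z 2 ^ 2) (r s : Fin 4) :
    klein i (pluckerMatrix x z r) (pluckerMatrix x z s) =
      (2 * pluckerMatrix x z r s) • kvec hi (x, z) := by
  ext (j | j) <;> fin_cases j <;>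
    simp only [klein, plucker_pluckerMatrix h, kvec_apply, Sum.elim_inl, Sum.elim_inr,
      Pi.smul_apply, smul_eq_mul] <;>
    simp [pluckerMatrix] <;> ring

theorem smul_klein_eq_zero {i : k} {a b : Fin 4 → k} {c d : k} (h : c • a + d • b = 0) :
    c • klein i a b = 0 ∧ d • klein i a b = 0 := by
  have h' : ∀ r, c * a r + d * b r = 0 := fun r => congrFun h r
  have h1 : ∀ r s, c * plucker a b r s = 0 := fun r s => by
    unfold plucker
    linear_combination b s * h' r - b r * h' s
  have h2 : ∀ r s, d * plucker a b r s = 0 := fun r s => by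
    unfold plucker
    linear_combination a r * h' s - a s * h' r
  constructor
  · ext (j | j) <;> fin_cases j <;> simp [klein, mul_add, mul_sub, h1, mul_left_comm c i]
  · ext (j | j) <;> fin_cases j <;> simp [klein, mul_add, mul_sub, h2, mul_left_comm d i]

theorem linearIndependent_of_klein_ne_zero {i : k} {a b : Fin 4 → k} (h : klein i a b ≠ 0) :
    LinearIndependent k ![a, b] := by
  rw [LinearIndependent.pair_iff]
  intro c d hcd
  obtain ⟨h1, h2⟩ := smul_klein_eq_zero (i := i) hcd
  exact ⟨(smul_eq_zero.mp h1).resolve_right h, (smul_eq_zero.mp h2).resolve_right h⟩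

variable [NeZero (2 : k)]

theorem exists_pluckerMatrix_ne_zero {x z : Fin 3 → k} (h : (x, z) ≠ 0) :
    ∃ r s, pluckerMatrix x z r s ≠ 0 := by
  by_contra! hz
  apply h
  have key : ∀ a b : k, a + b = 0 → a - b = 0 → a = 0 ∧ b = 0 := by
    intro a b h1 h2
    have ha : 2 * a = 0 := by linear_combination h1 + h2
    have hb : 2 * b = 0 := by linear_combination h1 - h2
    simpa [two_ne_zero] using And.intro ha hb
  have h0 := key (x 0) (z 0) (hz 0 1) (hz 2 3)
  have h1 := key (x 1) (z 1) (hz 2 0) (hz 1 3)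
  have h2 := key (x 2) (z 2) (hz 0 3) (hz 1 2)
  ext j
  · fin_cases j
    exacts [h0.1, h1.1, h2.1]
  · fin_cases j
    exacts [h0.2, h1.2, h2.2]

/-- The quadric equation says that the point comes from a line, recovered from two rows of
`pluckerMatrix`. The cubic says that `netMatrix` of that line is singular, and a kernel vector is
the parameter of a quadric containing it. -/
theorem mk_mem_humbertComplex_iff {i : k} (hi : i ^ 2 = -1) (p : (Fin 3 → k) × (Fin 3 → k))
    (hp : kvec hi p ≠ 0) :
    Projectivization.mk k (kvec hi p) hp ∈ humbertComplex i ↔ HumbertEqs p := by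
  simp only [humbertComplex, Set.mem_ofPred_eq, Projectivization.submodule_mk]
  constructor
  · rintro ⟨a, b, -, ⟨t, ht, hq⟩, hs⟩
    have hdet : (netMatrix a b).det = 0 := Matrix.exists_mulVec_eq_zero_iff.mp
      ⟨t, ht, (netMatrix_mulVec_eq_zero_iff a b t).mpr hq⟩
    obtain ⟨c, hc⟩ := Submodule.mem_span_singleton.mp
      (hs ▸ Submodule.mem_span_singleton_self (kvec hi p))
    have : p = c • (kvec hi).symm (klein i a b) := by
      rw [← map_smul, hc, LinearEquiv.symm_apply_apply]
    rw [this]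
    refine HumbertEqs.smul ⟨klein_symm_quadric hi a b, ?_⟩ c
    have := klein_symm_cubic hi a b
    rw [hdet, mul_zero] at this
    exact sub_eq_zero.mp this
  · rintro ⟨h1, h2⟩
    obtain ⟨x, z⟩ := p
    obtain ⟨r, s, hrs⟩ := exists_pluckerMatrix_ne_zero (x := x) (z := z)
      (fun h => hp (by rw [h, map_zero]))
    have hk := klein_pluckerMatrix hi h1 r s
    have hc : 2 * pluckerMatrix x z r s ≠ 0 := mul_ne_zero two_ne_zero hrs
    refine ⟨pluckerMatrix x z r, pluckerMatrix x z s, ?_, ?_, ?_⟩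
    · apply linearIndependent_of_klein_ne_zero (i := i)
      rw [hk]
      exact smul_ne_zero hc hp
    · have hcub := klein_symm_cubic hi (pluckerMatrix x z r) (pluckerMatrix x z s)
      rw [hk, map_smul, LinearEquiv.symm_apply_apply] at hcub
      have hdet : (netMatrix (pluckerMatrix x z r) (pluckerMatrix x z s)).det = 0 := by
        have := hcub.symm.trans (sub_eq_zero.mpr (HumbertEqs.smul ⟨h1, h2⟩ _).2)
        simpa [two_ne_zero] using this
      obtain ⟨t, ht, h⟩ := Matrix.exists_mulVec_eq_zero_iff.mpr hdet
      exact ⟨t, ht, (netMatrix_mulVec_eq_zero_iff _ _ t).mp h⟩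
    · rw [hk, Submodule.span_singleton_smul_eq (isUnit_iff_ne_zero.mpr hc)]

end Equations

/-! ### Products of linear forms -/

section LinearForms

variable {k V : Type*} [Field k] [AddCommGroup V] [Module k V]

/-- A vector space over an infinite field is not a finite union of proper subspaces. -/
theorem exists_eq_zero_of_prod_eq_zero [Infinite k] {n : ℕ} {f : Fin n → V →ₗ[k] k}
    (h : ∀ v, ∏ j, f j v = 0) : ∃ j, f j = 0 := by
  obtain ⟨j, hj⟩ := Subspace.exists_eq_top_of_iUnion_eq_univ
    (p := fun j => LinearMap.ker (f j)) (by
      rw [Set.eq_univ_iff_forall]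
      intro v
      obtain ⟨j, -, hj⟩ := Finset.prod_eq_zero_iff.mp (h v)
      exact Set.mem_iUnion.mpr ⟨j, hj⟩)
  exact ⟨j, LinearMap.ker_eq_top.mp hj⟩

theorem exists_smul_of_ker_le {f g : V →ₗ[k] k} (h : ∀ v, f v = 0 → g v = 0) :
    ∃ c : k, ∀ v, g v = c * f v := by
  by_cases hf : f = 0
  · exact ⟨0, fun v => by simp [h v (by simp [hf])]⟩
  obtain ⟨u, hu⟩ : ∃ u, f u ≠ 0 := by
    by_contra! h0
    exact hf (LinearMap.ext h0)
  refine ⟨g u / f u, fun v => ?_⟩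
  have := h (v - (f v / f u) • u) (by simp [hu])
  rw [map_sub, map_smul, smul_eq_mul, sub_eq_zero] at this
  rw [this]
  ring

/-- Linear forms are prime: restrict the product to the kernel of f, where one factor must vanish.
-/
theorem exists_smul_of_dvd_prod [Infinite k] {n : ℕ} {f : V →ₗ[k] k} {g : Fin n → V →ₗ[k] k}
    (h : ∀ v, f v = 0 → ∏ j, g j v = 0) : ∃ j, ∃ c : k, ∀ v, g j v = c * f v := by
  obtain ⟨j, hj⟩ := exists_eq_zero_of_prod_eq_zero
    (f := fun j => (g j) ∘ₗ (LinearMap.ker f).subtype) (fun v => h v v.2)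
  exact ⟨j, exists_smul_of_ker_le fun v hv => LinearMap.congr_fun hj ⟨v, hv⟩⟩

/-- Where f vanishes, approach v along the line v + t u with f u ≠ 0: the difference is a polynomial
in t that vanishes for all t ≠ 0, hence also at t = 0. -/
theorem eq_of_mul_eq_mul_linearForm [Infinite k] {f a b d e : V →ₗ[k] k} (hf : f ≠ 0)
    (h : ∀ v, f v * (a v * b v) = f v * (d v * e v)) (v : V) : a v * b v = d v * e v := by
  obtain ⟨u, hu⟩ : ∃ u, f u ≠ 0 := by
    by_contra! h0
    exact hf (LinearMap.ext h0)
  by_cases hv : f v = 0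
  swap
  · exact mul_left_cancel₀ hv (h v)
  let p : Polynomial k := .C (a v * b v - d v * e v) +
    .C (a v * b u + a u * b v - d v * e u - d u * e v) * .X + .C (a u * b u - d u * e u) * .X ^ 2
  have hp : p = 0 := by
    apply Polynomial.eq_zero_of_infinite_isRoot
    refine Set.Infinite.mono (s := {0}ᶜ) ?_ (Set.finite_singleton (0 : k)).infinite_compl
    intro t ht
    have h1 := h (v + t • u)
    have h2 : f (v + t • u) ≠ 0 := by simpa [hv, hu] using ht
    have h3 := mul_left_cancel₀ h2 h1
    simp only [map_add, map_smul, smul_eq_mul] at h3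
    change Polynomial.eval t p = 0
    simp only [p, Polynomial.eval_add, Polynomial.eval_mul, Polynomial.eval_C, Polynomial.eval_X,
      Polynomial.eval_pow]
    linear_combination h3
  have := congrArg (Polynomial.eval 0) hp
  simpa [p, sub_eq_zero] using this

theorem proportional_of_mul_eq_mul [Infinite k] {a b d e : V →ₗ[k] k} (hd : d ≠ 0)
    (h : ∀ v, a v * b v = d v * e v) :
    (∃ c : k, ∀ v, a v = c * d v ∧ e v = c * b v) ∨
      ∃ c : k, ∀ v, b v = c * d v ∧ e v = c * a v := by
  have cancel : ∀ {a b : V →ₗ[k] k} {c : k}, (∀ v, a v * b v = d v * e v) →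
      (∀ v, a v = c * d v) → ∀ v, e v = c * b v := by
    intro a b c h hc v
    obtain ⟨j, hj⟩ := exists_eq_zero_of_prod_eq_zero (f := ![d, e - c • b]) (fun v => by
      simp only [Fin.prod_univ_two, Matrix.cons_val_zero, Matrix.cons_val_one,
        LinearMap.sub_apply, LinearMap.smul_apply, smul_eq_mul]
      linear_combination b v * hc v - h v)
    fin_cases j
    · exact absurd hj hd
    · exact sub_eq_zero.mp (LinearMap.congr_fun hj v)
  obtain ⟨j, c, hc⟩ := exists_smul_of_dvd_prod (f := d) (g := ![a, b]) (fun v hv => by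
    simp [Fin.prod_univ_two, h, hv])
  fin_cases j
  · exact Or.inl ⟨c, fun v => ⟨hc v, cancel h hc v⟩⟩
  · exact Or.inr ⟨c, fun v => ⟨hc v, cancel (fun v => (mul_comm _ _).trans (h v)) hc v⟩⟩

/-- Unique factorization for three linear forms: z₀ divides some xⱼ, and after cancelling it the
remaining identity between products of two forms is `proportional_of_mul_eq_mul`. -/
theorem exists_perm_of_prod_eq_prod [Infinite k] {x z : Fin 3 → V →ₗ[k] k} (hz : ∀ l, z l ≠ 0)
    (h : ∀ v, ∏ j, x j v = ∏ j, z j v) :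
    ∃ (σ : Equiv.Perm (Fin 3)) (c : Fin 3 → k), ∏ l, c l = 1 ∧
      ∀ l v, x (σ l) v = c l * z l v := by
  obtain ⟨j, c₀, hc₀⟩ := exists_smul_of_dvd_prod (f := z 0) (g := x) (fun v hv => by
    simp [h, Fin.prod_univ_three, hv])
  -- Reorder so that the factor proportional to z₀ comes first; its scalar c₀ is moved into the next
  -- factor before cancelling z₀.
  obtain ⟨x', hx'⟩ : ∃ x' : Fin 3 → V →ₗ[k] k, x' = fun l => x (Equiv.swap 0 j l) := ⟨_, rfl⟩
  have h' : ∀ v, z 0 v * ((c₀ • x' 1) v * x' 2 v) = z 0 v * (z 1 v * z 2 v) := by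
    intro v
    have h1 : ∏ l, x' l v = ∏ l, x l v := by
      rw [hx']
      exact Equiv.prod_comp (Equiv.swap 0 j) (fun l => x l v)
    rw [h v, Fin.prod_univ_three, Fin.prod_univ_three] at h1
    have h2 : x' 0 v = c₀ * z 0 v := by rw [hx', ← hc₀]; simp
    rw [h2] at h1
    simp only [LinearMap.smul_apply, smul_eq_mul]
    linear_combination h1
  have h0 : ∀ l v, x' l v = x (Equiv.swap 0 j l) v := fun l v => by rw [hx']
  have hne : ∀ {c : k} {f : V →ₗ[k] k} {l}, (∀ v, z l v = c * f v) → c ≠ 0 := by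
    rintro c f l hl rfl
    exact hz l (LinearMap.ext fun v => by simp [hl])
  rcases proportional_of_mul_eq_mul (hz 1) (eq_of_mul_eq_mul_linearForm (hz 0) h') with
    ⟨c, hc⟩ | ⟨c, hc⟩
  · have hc0 : c ≠ 0 := hne fun v => (hc v).2
    have hc₀0 : c₀ ≠ 0 := by
      rintro rfl
      refine hz 1 (LinearMap.ext fun v => ?_)
      simpa [hc0] using (hc v).1.symm
    -- Solve c₀ x'₁ = c z₁ and z₂ = c x'₂ for x'₁ and x'₂.
    refine ⟨Equiv.swap 0 j, ![c₀, c₀⁻¹ * c, c⁻¹], ?_, ?_⟩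
    · rw [Fin.prod_univ_three]
      simp only [Matrix.cons_val]
      field_simp
    · intro l v
      obtain ⟨h1, h2⟩ := hc v
      rw [← h0]
      fin_cases l
      · simpa [hx'] using hc₀ v
      · simp only [Fin.mk_one, Matrix.cons_val]
        rw [mul_assoc, ← h1]
        simp [hc₀0]
      · simp only [Fin.reduceFinMk, Matrix.cons_val]
        rw [h2]
        field_simp
  · have hc2 : ∀ v, z 2 v = (c * c₀) * x' 1 v := fun v => by
      rw [(hc v).2]; simp [mul_assoc]
    have hcc : c * c₀ ≠ 0 := hne hc2
    have hc0 := left_ne_zero_of_mul hcc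
    have hc₀0 := right_ne_zero_of_mul hcc
    -- Here x'₂ = c z₁ and z₂ = c c₀ x'₁, so the last two factors are interchanged.
    refine ⟨Equiv.swap 0 j * Equiv.swap 1 2, ![c₀, c, (c * c₀)⁻¹], ?_, ?_⟩
    · rw [Fin.prod_univ_three]
      simp only [Matrix.cons_val]
      field_simp
    · intro l v
      rw [Equiv.Perm.mul_apply, ← h0]
      fin_cases l
      · have : Equiv.swap (1 : Fin 3) 2 0 = 0 := by decide
        simpa [hx', this] using hc₀ v
      · simpa using (hc v).1
      · simp only [Fin.reduceFinMk, Matrix.cons_val, Equiv.swap_apply_right]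
        rw [hc2]
        field_simp

end LinearForms

/-! ### The planes in the Humbert complex -/

section Planes

variable {k : Type*} [Field k]

/-- The symmetric bilinear form of the quadric `∑ xⱼ² = ∑ zⱼ²`. -/
def polarForm (k : Type*) [Field k] : LinearMap.BilinForm k ((Fin 3 → k) × (Fin 3 → k)) :=
  LinearMap.mk₂ k (fun p q => p.1 ⬝ᵥ q.1 - p.2 ⬝ᵥ q.2)
    (fun p p' q => by simp; ring) (fun c p q => by simp [mul_sub])
    (fun p q q' => by simp; ring) (fun c p q => by simp [mul_sub])

theorem polarForm_apply (p q : (Fin 3 → k) × (Fin 3 → k)) :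
    polarForm k p q = p.1 ⬝ᵥ q.1 - p.2 ⬝ᵥ q.2 := rfl

theorem polarForm_comm (p q : (Fin 3 → k) × (Fin 3 → k)) :
    polarForm k p q = polarForm k q p := by
  simp only [polarForm_apply, dotProduct_comm]

theorem polarForm_nondegenerate : (polarForm k).Nondegenerate := by
  have h : ∀ p, (∀ q, polarForm k p q = 0) → p = 0 := by
    intro p hp
    ext j
    · simpa [polarForm_apply] using hp (Pi.single j 1, 0)
    · simpa [polarForm_apply] using hp (0, Pi.single j 1)
  exact ⟨h, fun q hq => h q fun p => (polarForm_comm q p).trans (hq p)⟩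

theorem HumbertEqs.polarForm_self {p : (Fin 3 → k) × (Fin 3 → k)} (hp : HumbertEqs p) :
    polarForm k p p = 0 := by
  rw [polarForm_apply, dotProduct, dotProduct, Fin.sum_univ_three, Fin.sum_univ_three]
  linear_combination hp.1

variable [NeZero (2 : k)]

/-- By polarization W is contained in its orthogonal, and both have dimension 3 = 6 - 3. -/
theorem orthogonal_eq_self {W : Submodule k ((Fin 3 → k) × (Fin 3 → k))}
    (h3 : Module.finrank k W = 3) (hW : ∀ p ∈ W, polarForm k p p = 0) :
    (polarForm k).orthogonal W = W := by
  symm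
  apply Submodule.eq_of_le_of_finrank_eq
  · intro q hq p hp
    have h1 := hW _ (W.add_mem hp hq)
    simp only [map_add, LinearMap.add_apply, hW p hp, hW q hq, zero_add, add_zero] at h1
    rw [polarForm_comm q p, ← two_mul] at h1
    exact (mul_eq_zero.mp h1).resolve_left two_ne_zero
  · rw [LinearMap.BilinForm.finrank_orthogonal polarForm_nondegenerate, h3]
    simp

/-- The graph of an element of the tetrahedral representation. -/
def graphPlane (k : Type*) [Field k] [NeZero (2 : k)] (s : Equiv.Perm (Fin 4)) :
    Submodule k ((Fin 3 → k) × (Fin 3 → k)) :=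
  (tet k s).mulVecLin.graph

theorem mem_graphPlane {s : Equiv.Perm (Fin 4)} {p : (Fin 3 → k) × (Fin 3 → k)} :
    p ∈ graphPlane k s ↔ p.2 = (tet k s).mulVec p.1 := by
  simp [graphPlane, LinearMap.mem_graph_iff]

theorem finrank_graphPlane (s : Equiv.Perm (Fin 4)) : Module.finrank k (graphPlane k s) = 3 := by
  rw [graphPlane, LinearMap.graph_eq_range_prod, LinearMap.finrank_range_of_inj]
  · simp
  · intro u v h
    exact congrArg Prod.fst h

theorem graphPlane_injective : Function.Injective (graphPlane k) := by
  intro s t h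
  apply tet_injective (k := k)
  apply Matrix.ext_of_mulVec_single
  intro j
  have : ((Pi.single j 1, (tet k s).mulVec (Pi.single j 1)) : (Fin 3 → k) × (Fin 3 → k)) ∈
      graphPlane k t := h ▸ mem_graphPlane.mpr rfl
  exact mem_graphPlane.mp this

theorem humbertEqs_of_mem_graphPlane {s : Equiv.Perm (Fin 4)} {p : (Fin 3 → k) × (Fin 3 → k)}
    (hp : p ∈ graphPlane k s) : HumbertEqs p := by
  obtain ⟨σ, ε, hε, h⟩ := exists_signedPerm_of_perm s
  have h2 : ∀ j, p.2 j = ((ε j : ℤ) : k) * p.1 (σ j) := fun j => by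
    rw [mem_graphPlane.mp hp, tet_mulVec_eq_iff s σ ε h]
  have hsq : ∀ j, ((ε j : ℤ) : k) ^ 2 = 1 := fun j => by
    rw [← Int.cast_pow, ← Units.val_pow_eq_pow_val, Int.units_sq]
    simp
  have hprod : ((ε 0 : ℤ) : k) * ((ε 1 : ℤ) : k) * ((ε 2 : ℤ) : k) = 1 := by
    rw [Fin.prod_univ_three] at hε
    rw [← Int.cast_mul, ← Int.cast_mul, ← Units.val_mul, ← Units.val_mul, hε]
    simp
  have s1 := Equiv.sum_comp σ (fun j => p.1 j ^ 2)
  have s2 := Equiv.prod_comp σ (fun j => p.1 j)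
  rw [Fin.sum_univ_three, Fin.sum_univ_three] at s1
  rw [Fin.prod_univ_three, Fin.prod_univ_three] at s2
  constructor
  · simp only [h2, mul_pow, hsq, one_mul, s1]
  · simp only [h2]
    linear_combination -s2 - (p.1 (σ 0) * p.1 (σ 1) * p.1 (σ 2)) * hprod

/-- The cubic, read as an identity of products of linear forms on W, gives x_{σ l} = c_l z_l; the
quadric then makes each c_l a sign, and ∏ c_l = 1 makes the number of minus signs even. -/
theorem eq_graphPlane_of_humbertEqs [Infinite k] {W : Submodule k ((Fin 3 → k) × (Fin 3 → k))}
    (h3 : Module.finrank k W = 3) (hW : ∀ p ∈ W, HumbertEqs p) : ∃ s, W = graphPlane k s := by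
  have horth := orthogonal_eq_self h3 fun p hp => (hW p hp).polarForm_self
  let x : Fin 3 → W →ₗ[k] k := fun j => LinearMap.proj j ∘ₗ LinearMap.fst k _ _ ∘ₗ W.subtype
  let z : Fin 3 → W →ₗ[k] k := fun j => LinearMap.proj j ∘ₗ LinearMap.snd k _ _ ∘ₗ W.subtype
  have hz : ∀ l, z l ≠ 0 := by
    intro l hl
    -- If z_l vanished on W, the vector with only coordinate z_l = 1 would be orthogonal to W, hence
    -- in W, a contradiction.
    have hmem : ((0, Pi.single l 1) : (Fin 3 → k) × (Fin 3 → k)) ∈ W := by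
      rw [← horth]
      intro p hp
      have : p.2 l = 0 := LinearMap.congr_fun hl ⟨p, hp⟩
      simp [polarForm_apply, this]
    simpa [z] using LinearMap.congr_fun hl ⟨_, hmem⟩
  obtain ⟨σ, c, hc, h⟩ := exists_perm_of_prod_eq_prod (x := x) hz (fun w => by
    rw [Fin.prod_univ_three, Fin.prod_univ_three]
    exact (hW w w.2).2)
  have h' : ∀ p ∈ W, ∀ l, p.1 (σ l) = c l * p.2 l := fun p hp l => h l ⟨p, hp⟩
  have hinj : Function.Injective (LinearMap.snd k (Fin 3 → k) (Fin 3 → k) ∘ₗ W.subtype) := by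
    rw [injective_iff_map_eq_zero]
    rintro ⟨p, hp⟩ h0
    have h2 : p.2 = 0 := h0
    ext j
    · have := h' p hp (σ.symm j)
      simpa [h2] using this
    · simp [h2]
  have hsurj := (LinearMap.injective_iff_surjective_of_finrank_eq_finrank
    (by rw [h3]; simp)).mp hinj
  -- The projection to z is onto, so the quadric can be evaluated where z is a standard basis
  -- vector.
  have hsq : ∀ l, c l ^ 2 = 1 := by
    intro l
    obtain ⟨⟨p, hp⟩, hpl⟩ := hsurj (Pi.single l 1)
    have hp2 : p.2 = Pi.single l 1 := hpl
    have h1 := (hW p hp).1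
    have s1 := Equiv.sum_comp σ (fun j => p.1 j ^ 2)
    rw [Fin.sum_univ_three, Fin.sum_univ_three] at s1
    rw [← s1] at h1
    simp only [h' p hp, hp2] at h1
    fin_cases l <;> simpa using h1
  have hunit : ∀ l, ∃ e : ℤˣ, ((e : ℤ) : k) = c l := by
    intro l
    rcases mul_self_eq_one_iff.mp ((sq (c l)).symm.trans (hsq l)) with h1 | h1
    · exact ⟨1, by simp [h1]⟩
    · exact ⟨-1, by simp [h1]⟩
  choose e he using hunit
  have hee : ∏ l, e l = 1 := by
    rcases Int.units_eq_one_or (∏ l, e l) with h1 | h1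
    · exact h1
    · exfalso
      have h2 : (((∏ l, e l : ℤˣ) : ℤ) : k) = 1 := by
        simp only [Fin.prod_univ_three, Units.val_mul, Int.cast_mul, he] at hc ⊢
        exact hc
      rw [h1] at h2
      have h3 : (2 : k) = 0 := by
        have : (-1 : k) = 1 := by simpa using h2
        linear_combination -this
      exact two_ne_zero h3
  obtain ⟨s, hs⟩ := exists_vertexSign_of_signedPerm σ e hee
  refine ⟨s, Submodule.eq_of_le_of_finrank_eq ?_ (h3.trans (finrank_graphPlane s).symm)⟩
  intro p hp
  rw [mem_graphPlane, tet_mulVec_eq_iff s σ e hs]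
  ext l
  rw [h' p hp, he, ← mul_assoc, ← sq, hsq, one_mul]

end Planes

/-! ### Linear transformations that permute the planes -/

section Permutations

open Equiv

/-- The counted elements lie in the centralizer of a transposition, which has order 4. -/
theorem card_involutions_commuting_swap : ∀ τ : Perm (Fin 4), τ * τ = 1 → τ ≠ 1 →
    (∃ a, τ a = a) →
    (Finset.univ.filter fun g : Perm (Fin 4) => g * g = 1 ∧ τ * g * (τ * g) = 1).card ≤ 5 := by
  decide +kernel

theorem card_fixedPointFree_involutions :
    (Finset.univ.filter fun g : Perm (Fin 4) =>
      g * g = 1 ∧ ¬(g ≠ 1 ∧ ∃ a, g a = a)).card ≤ 5 := by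
  decide +kernel

/-- A subset of 𝔖₄ closed under products, all of whose elements have square 1, is commutative, hence
too small: if it contains a transposition it lies in its centralizer, otherwise among the double
transpositions and 1. -/
theorem exists_mul_self_ne_one {S : Finset (Perm (Fin 4))} (hS : 6 ≤ S.card)
    (hmul : ∀ g ∈ S, ∀ h ∈ S, g * h ∈ S) : ∃ g ∈ S, g * g ≠ 1 := by
  by_contra! hsq
  by_cases hτ : ∃ τ ∈ S, τ ≠ 1 ∧ ∃ a, τ a = a
  · obtain ⟨τ, hτS, h1, h2⟩ := hτ
    have := Finset.card_le_card (s := S) (t := Finset.univ.filter fun g : Perm (Fin 4) =>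
      g * g = 1 ∧ τ * g * (τ * g) = 1) (fun g hg => by
        simpa using And.intro (hsq g hg) (hsq _ (hmul τ hτS g hg)))
    have := card_involutions_commuting_swap τ (hsq τ hτS) h1 h2
    omega
  · have := Finset.card_le_card (s := S) (t := Finset.univ.filter fun g : Perm (Fin 4) =>
      g * g = 1 ∧ ¬(g ≠ 1 ∧ ∃ a, g a = a)) (fun g hg =>
        Finset.mem_filter.mpr ⟨Finset.mem_univ _, hsq g hg, fun h => hτ ⟨g, hg, h⟩⟩)
    have := card_fixedPointFree_involutions
    omega

/-- Such a g is a 3-cycle, and a is its fixed letter, or a 4-cycle, and any a works. -/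
theorem exists_transitive_off_point : ∀ g : Perm (Fin 4), g * g ≠ 1 →
    ∃ a, ∀ b, b ≠ a → ∀ c, c ≠ a → ∃ n : Fin 4, (g ^ (n : ℕ)) b = c := by
  decide +kernel

theorem card_stabilizer_fin_four : ∀ a : Fin 4,
    (Finset.univ.filter fun g : Perm (Fin 4) => g a = a).card = 6 := by
  decide +kernel

theorem eq_of_fixes_of_swap : ∀ s t : Perm (Fin 4), s ≠ 1 → t ≠ 1 →
    (∃ c d, c ≠ d ∧ s c = c ∧ s d = d) → (∀ a, s a = a → t a = a) → t = s := by
  decide +kernel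

/-- The permutations preserving {a, b} form a Klein four-group, of which three elements are
excluded. -/
theorem eq_double_of_preserves : ∀ t : Perm (Fin 4), ∀ a b c d : Fin 4, t ≠ 1 → t ≠ swap a b →
    t ≠ swap c d → a ≠ b → a ≠ c → a ≠ d → b ≠ c → b ≠ d → c ≠ d → (t a = a ∨ t a = b) →
    (t b = a ∨ t b = b) → t = swap a b * swap c d := by
  decide +kernel

theorem eq_cycle_of_fixes : ∀ t : Perm (Fin 4), t ≠ 1 → t ≠ swap 1 2 → t ≠ swap 2 3 →
    t ≠ swap 1 3 → t 0 = 0 → t = swap 1 2 * swap 2 3 ∨ t = swap 2 3 * swap 1 2 := by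
  decide +kernel

variable {k : Type*} [Field k] [NeZero (2 : k)]

/-- All frame coefficients of u other than the one at a coincide; their common value contributes
nothing because the vertices sum to zero. -/
theorem exists_eq_smul_vertex_of_tet_eq {g : Perm (Fin 4)} (hg : g * g ≠ 1) {u : Fin 3 → k}
    (h : (tet k g).mulVec u = u) : ∃ (a : Fin 4) (c : k), u = c • vertex k a := by
  obtain ⟨a, ha⟩ := exists_transitive_off_point g hg
  obtain ⟨b, hb⟩ : ∃ b : Fin 4, b ≠ a := exists_ne a
  have hconst : ∀ c, c ≠ a → vertex k c ⬝ᵥ u = vertex k b ⬝ᵥ u := by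
    intro c hc
    obtain ⟨n, rfl⟩ := ha b hb c hc
    exact vertex_dotProduct_eq_of_tet_eq h n b
  refine ⟨a, 4⁻¹ * (vertex k a ⬝ᵥ u - vertex k b ⬝ᵥ u), ?_⟩
  have h1 : ∀ c, (4 : k)⁻¹ * (vertex k c ⬝ᵥ u) =
      (if c = a then 4⁻¹ * (vertex k a ⬝ᵥ u - vertex k b ⬝ᵥ u) else 0) +
        4⁻¹ * (vertex k b ⬝ᵥ u) := by
    intro c
    split_ifs with hc
    · rw [hc]; ring
    · rw [hconst c hc]; ring
  conv_lhs => rw [eq_sum_vertex u]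
  rw [Finset.sum_congr rfl fun c _ => congrArg (· • vertex k c) (h1 c)]
  simp_rw [add_smul, Finset.sum_add_distrib, ← Finset.smul_sum, sum_vertex]
  simp

theorem pair_eq_of_vertex_add_eq {a b c d : Fin 4} (hab : a ≠ b)
    (h : vertex k c + vertex k d = vertex k a + vertex k b) : (c = a ∨ c = b) ∧ (d = a ∨ d = b) := by
  have key : ∀ {c d : Fin 4}, vertex k c + vertex k d = vertex k a + vertex k b →
      c = a ∨ c = b := by
    intro c d h
    by_contra! hc
    have h1 := congrArg (vertex k c ⬝ᵥ ·) h
    have h4 := four_ne_zero_of_two (k := k)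
    simp only [dotProduct_add, vertex_dotProduct, if_true, if_neg hc.1, if_neg hc.2] at h1
    split_ifs at h1 with hcd
    · subst hcd
      have h2 := congrArg (vertex k a ⬝ᵥ ·) h
      simp only [dotProduct_add, vertex_dotProduct, if_true, if_neg hc.1.symm, if_neg hab] at h2
      apply h4
      linear_combination -h2
    · apply h4
      linear_combination h1
  exact ⟨key h, key (d := c) (by rw [add_comm, h])⟩

end Permutations

/-! ### Rigidity of the arrangement of the 24 graphs -/

section Rigidity

open Equiv

variable {k : Type*} [Field k] [NeZero (2 : k)]

/-- A linear transformation maps each of the planes into one of the planes. -/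
def PermutesPlanes (A : ((Fin 3 → k) × (Fin 3 → k)) →ₗ[k] (Fin 3 → k) × (Fin 3 → k)) : Prop :=
  ∀ s, ∃ t, ∀ p ∈ graphPlane k s, A p ∈ graphPlane k t

variable {A : ((Fin 3 → k) × (Fin 3 → k)) →ₗ[k] (Fin 3 → k) × (Fin 3 → k)}

/-- The image of a graph under an injective map fills the graph that contains it, by dimension; so A
induces an injection on the set of graphs. -/
theorem eq_of_map_graphPlane_le (hA : Function.Injective A) {s s' t : Perm (Fin 4)}
    (hs : ∀ p ∈ graphPlane k s, A p ∈ graphPlane k t)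
    (hs' : ∀ p ∈ graphPlane k s', A p ∈ graphPlane k t) : s = s' := by
  apply graphPlane_injective (k := k)
  have key : ∀ {r}, (∀ p ∈ graphPlane k r, A p ∈ graphPlane k t) →
      (graphPlane k r).map A = graphPlane k t := by
    intro r hr
    apply Submodule.eq_of_le_of_finrank_eq
    · exact Submodule.map_le_iff_le_comap.mpr hr
    · rw [(Submodule.equivMapOfInjective A hA _).finrank_eq.symm, finrank_graphPlane,
        finrank_graphPlane]
  exact Submodule.map_injective_of_injective hA ((key hs).trans (key hs').symm)

/-- The graph of s meets the diagonal in the fixed space of s; this turns incidence of planes into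
group theory. -/
theorem diag_mem_graphPlane_iff {s : Perm (Fin 4)} {u : Fin 3 → k} :
    ((u, u) : (Fin 3 → k) × (Fin 3 → k)) ∈ graphPlane k s ↔ (tet k s).mulVec u = u := by
  rw [mem_graphPlane]
  exact eq_comm

/-- A transformation permuting the planes and preserving the diagonal plane induces on that plane,
up to a scalar, an element of the tetrahedral group. -/
theorem exists_tet_of_preserves_diag (hA : Function.Injective A) (hP : PermutesPlanes A)
    (h1 : ∀ p ∈ graphPlane k 1, A p ∈ graphPlane k 1) :
    ∃ (c : k) (s : Perm (Fin 4)), ∀ u, A (u, u) = c • ((tet k s).mulVec u, (tet k s).mulVec u) := by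
  classical
  choose π hπ using hP
  have hπinj : Function.Injective π := fun s s' h =>
    eq_of_map_graphPlane_le hA (hπ s) (by rw [h]; exact hπ s')
  have hdiag : ∀ u, ∃ v, A (u, u) = (v, v) := by
    intro u
    have := mem_graphPlane.mp (h1 (u, u) (diag_mem_graphPlane_iff.mpr (tet_one_mulVec u)))
    rw [tet_one_mulVec] at this
    exact ⟨(A (u, u)).1, Prod.ext rfl this⟩
  have hvertex : ∀ a, ∃ (b : Fin 4) (c : k), A (vertex k a, vertex k a) =
      (c • vertex k b, c • vertex k b) := by
    intro a
    obtain ⟨v, hv⟩ := hdiag (vertex k a)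
    -- Six graphs pass through (v_a, v_a), one for each s fixing a. Their images are six graphs
    -- through (v, v), so the stabilizer of v has at least six elements and contains a 3-cycle or a
    -- 4-cycle.
    obtain ⟨g, hg, hgg⟩ := exists_mul_self_ne_one
      (S := Finset.univ.filter fun g => (tet k g).mulVec v = v)
      (by
        rw [← card_stabilizer_fin_four a]
        refine Finset.card_le_card_of_injOn π (fun g hg => ?_) hπinj.injOn
        have hga : g a = a := by simpa using hg
        have := hπ g _ (diag_mem_graphPlane_iff.mpr (by rw [tet_mulVec_vertex, hga]))
        rw [hv, diag_mem_graphPlane_iff] at this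
        simpa using this)
      (fun g hg h hh => by
        simp only [Finset.mem_filter, Finset.mem_univ, true_and] at hg hh ⊢
        rw [← tet_mulVec_mulVec, hh, hg])
    obtain ⟨b, c, rfl⟩ := exists_eq_smul_vertex_of_tet_eq hgg (Finset.mem_filter.mp hg).2
    exact ⟨b, c, hv⟩
  choose f c hfc using hvertex
  have hc : ∀ a, c a ≠ 0 := by
    intro a ha
    have := hfc a
    rw [ha, zero_smul] at this
    have h0 := hA (this.trans (map_zero A).symm)
    exact vertex_ne_zero a (congrArg Prod.fst h0)
  have hf : Function.Injective f := by
    intro a b hab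
    have : A (c b • (vertex k a, vertex k a)) = A (c a • (vertex k b, vertex k b)) := by
      rw [map_smul, map_smul, hfc, hfc, hab]
      simp only [Prod.smul_mk, smul_smul, mul_comm]
    have h2 : c b • vertex k a = c a • vertex k b := congrArg Prod.fst (hA this)
    refine vertex_eq_smul (k := k) (c := (c b)⁻¹ * c a) ?_
    rw [mul_smul, ← h2, inv_smul_smul₀ (hc b)]
  let s : Perm (Fin 4) := Equiv.ofBijective f (Finite.injective_iff_bijective.mp hf)
  have hsum : ∑ a, c a • vertex k (f a) = 0 := by
    have : ∑ a, A (vertex k a, vertex k a) = 0 := by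
      rw [← map_sum, show ∑ a, (vertex k a, vertex k a) = (0 : (Fin 3 → k) × (Fin 3 → k)) by
        ext1 <;> simp [Prod.fst_sum, Prod.snd_sum, sum_vertex], map_zero]
    simpa [hfc, Prod.fst_sum] using congrArg Prod.fst this
  -- The only linear relations among the vertices have equal coefficients; pairing with one vertex
  -- shows this.
  have hconst : ∀ b, 4 * c b = ∑ a, c a := by
    intro b
    have := congrArg (vertex k (f b) ⬝ᵥ ·) hsum
    have h2 : ∀ a, c a * (if f b = f a then (3 : k) else -1) =
        (if b = a then 4 * c a else 0) - c a := by
      intro a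
      simp only [hf.eq_iff]
      split_ifs <;> ring
    simp only [dotProduct_sum, dotProduct_smul, vertex_dotProduct, smul_eq_mul, dotProduct_zero,
      h2, Finset.sum_sub_distrib] at this
    simpa [sub_eq_zero] using this
  refine ⟨4⁻¹ * ∑ a, c a, s, fun u => ?_⟩
  have : A ∘ₗ (LinearMap.id.prod LinearMap.id) = (4⁻¹ * ∑ a, c a) •
      ((tet k s).mulVecLin.prod (tet k s).mulVecLin) := by
    apply linearMap_ext_vertex
    intro a
    have hca : 4⁻¹ * ∑ b, c b = c a := by
      rw [← hconst a, inv_mul_cancel_left₀ four_ne_zero_of_two]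
    change A (vertex k a, vertex k a) =
      (4⁻¹ * ∑ a, c a) • ((tet k s).mulVec (vertex k a), (tet k s).mulVec (vertex k a))
    rw [hfc, hca, tet_mulVec_vertex]
    rfl
  exact LinearMap.congr_fun this u

theorem tet_double_one (u : Fin 3 → k) :
    (tet k (swap 0 1 * swap 2 3)).mulVec u = ![u 0, -u 1, -u 2] := by
  rw [tet_mulVec_eq_iff _ 1 ![1, -1, -1] (by decide)]
  ext j
  fin_cases j <;> simp

theorem tet_double_two (u : Fin 3 → k) :
    (tet k (swap 0 2 * swap 1 3)).mulVec u = ![-u 0, u 1, -u 2] := by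
  rw [tet_mulVec_eq_iff _ 1 ![-1, 1, -1] (by decide)]
  ext j
  fin_cases j <;> simp

theorem tet_double_three (u : Fin 3 → k) :
    (tet k (swap 0 3 * swap 1 2)).mulVec u = ![-u 0, -u 1, u 2] := by
  rw [tet_mulVec_eq_iff _ 1 ![-1, -1, 1] (by decide)]
  ext j
  fin_cases j <;> simp

theorem tet_swap_one_two (u : Fin 3 → k) :
    (tet k (swap 1 2)).mulVec u = ![u 1, u 0, u 2] := by
  rw [tet_mulVec_eq_iff _ (swap 0 1) 1 (by decide)]
  have : (swap 0 1 : Perm (Fin 3)) 2 = 2 := by decide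
  ext j
  fin_cases j <;> simp [this]

theorem tet_swap_two_three (u : Fin 3 → k) :
    (tet k (swap 2 3)).mulVec u = ![u 0, u 2, u 1] := by
  rw [tet_mulVec_eq_iff _ (swap 1 2) 1 (by decide)]
  have : (swap 1 2 : Perm (Fin 3)) 0 = 0 := by decide
  ext j
  fin_cases j <;> simp [this]

/-- A transformation permuting the planes and acting as a scalar on the diagonal plane is a scalar,
or a scalar multiple of the exchange of the two coordinate spaces. -/
theorem eq_smul_or_eq_smul_swap (hA : Function.Injective A) (hP : PermutesPlanes A) {c : k}
    (hc : ∀ u, A (u, u) = c • (u, u)) :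
    (∀ x z, A (x, z) = c • (x, z)) ∨ ∀ x z, A (x, z) = c • (z, x) := by
  choose π hπ using hP
  have hπinj : Function.Injective π := fun s s' h =>
    eq_of_map_graphPlane_le hA (hπ s) (by rw [h]; exact hπ s')
  have hc0 : c ≠ 0 := by
    rintro rfl
    have := hA ((hc (vertex k 0)).trans ((zero_smul k _).trans (map_zero A).symm))
    exact vertex_ne_zero 0 (congrArg Prod.fst this)
  -- Since A is a scalar on the diagonal, the fixed space of s is contained in that of π s.
  have hfix : ∀ s u, (tet k s).mulVec u = u → (tet k (π s)).mulVec u = u := by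
    intro s u hu
    have := hπ s _ (diag_mem_graphPlane_iff.mpr hu)
    rw [hc, Submodule.smul_mem_iff _ hc0] at this
    exact diag_mem_graphPlane_iff.mp this
  have hfix' : ∀ s a, s a = a → π s a = a := by
    intro s a ha
    have := hfix s (vertex k a) (by rw [tet_mulVec_vertex, ha])
    rw [tet_mulVec_vertex] at this
    exact vertex_injective this
  have hone : π 1 = 1 := Equiv.ext fun a => hfix' 1 a rfl
  have hne : ∀ {s}, s ≠ 1 → π s ≠ 1 := fun hs h => hs (hπinj (h.trans hone.symm))
  have hswap : ∀ a b, a ≠ b → π (swap a b) = swap a b := by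
    intro a b hab
    refine eq_of_fixes_of_swap _ _ (swap_eq_one_iff.not.mpr hab)
      (hne (swap_eq_one_iff.not.mpr hab)) ?_ (hfix' _)
    revert a b
    decide
  have hdouble : ∀ a b c d : Fin 4, a ≠ b → a ≠ c → a ≠ d → b ≠ c → b ≠ d → c ≠ d →
      π (swap a b * swap c d) = swap a b * swap c d := by
    intro a b c d hab hac had hbc hbd hcd
    -- If s exchanges a and b, it fixes v_a + v_b; so does π s, which must then preserve {a, b}.
    have hpair : ∀ s : Perm (Fin 4), s a = b → s b = a →
        (π s a = a ∨ π s a = b) ∧ (π s b = a ∨ π s b = b) := by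
      intro s h1 h2
      have := hfix s (vertex k a + vertex k b) (by
        rw [Matrix.mulVec_add, tet_mulVec_vertex, tet_mulVec_vertex, h1, h2, add_comm])
      rw [Matrix.mulVec_add, tet_mulVec_vertex, tet_mulVec_vertex] at this
      exact pair_eq_of_vertex_add_eq hab this
    have hda : (swap a b * swap c d) a = b := by
      rw [Perm.mul_apply, swap_apply_of_ne_of_ne hac had, swap_apply_left]
    have hdb : (swap a b * swap c d) b = a := by
      rw [Perm.mul_apply, swap_apply_of_ne_of_ne hbc hbd, swap_apply_right]
    have hdc : (swap a b * swap c d) c = d := by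
      rw [Perm.mul_apply, swap_apply_left, swap_apply_of_ne_of_ne had.symm hbd.symm]
    obtain ⟨h1, h2⟩ := hpair _ hda hdb
    refine eq_double_of_preserves _ a b c d (hne fun h => ?_) (fun h => ?_) (fun h => ?_)
      hab hac had hbc hbd hcd h1 h2
    · rw [h] at hda
      exact hab hda
    · have := hπinj (h.trans (hswap a b hab).symm)
      rw [this, swap_apply_of_ne_of_ne hac.symm hbc.symm] at hdc
      exact hcd hdc
    · have := hπinj (h.trans (hswap c d hcd).symm)
      rw [this, swap_apply_of_ne_of_ne hac had] at hda
      exact hab hda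
  have hd1 := hdouble 0 1 2 3 (by decide) (by decide) (by decide) (by decide) (by decide) (by decide)
  have hd2 := hdouble 0 2 1 3 (by decide) (by decide) (by decide) (by decide) (by decide) (by decide)
  have hd3 := hdouble 0 3 1 2 (by decide) (by decide) (by decide) (by decide) (by decide) (by decide)
  have m1 := hπ (swap 0 1 * swap 2 3)
  have m2 := hπ (swap 0 2 * swap 1 3)
  have m3 := hπ (swap 0 3 * swap 1 2)
  have m4 := hπ (swap 1 2)
  have m5 := hπ (swap 2 3)
  rw [hd1] at m1
  rw [hd2] at m2
  rw [hd3] at m3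
  rw [hswap 1 2 (by decide)] at m4
  rw [hswap 2 3 (by decide)] at m5
  simp only [mem_graphPlane, tet_double_one] at m1
  simp only [mem_graphPlane, tet_double_two] at m2
  simp only [mem_graphPlane, tet_double_three] at m3
  simp only [mem_graphPlane, tet_swap_one_two] at m4
  simp only [mem_graphPlane, tet_swap_two_three] at m5
  have half : ∀ {a : k}, a = -a → a = 0 := fun {a} h => by
    have : 2 * a = 0 := by linear_combination h
    exact (mul_eq_zero.mp this).resolve_left two_ne_zero
  -- The graphs of two double transpositions, which act by diagonal signs, meet exactly in this
  -- line, and both graphs are preserved.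
  have e0 : ∃ l : k, A (![1, 0, 0], ![-1, 0, 0]) =
      l • ((![1, 0, 0], ![-1, 0, 0]) : (Fin 3 → k) × (Fin 3 → k)) := by
    have h2 := m2 (![1, 0, 0], ![-1, 0, 0]) (by simp)
    have h3 := m3 (![1, 0, 0], ![-1, 0, 0]) (by simp)
    generalize A (![1, 0, 0], ![-1, 0, 0]) = q at h2 h3
    obtain ⟨x, z⟩ := q
    dsimp only at h2 h3
    subst h2
    have h31 := congrFun h3 1
    have h32 := congrFun h3 2
    simp only [Matrix.cons_val] at h31 h32
    refine ⟨x 0, ?_⟩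
    ext j <;> fin_cases j <;> simp [half h31, half h32.symm]
  have e1 : ∃ l : k, A (![0, 1, 0], ![0, -1, 0]) =
      l • ((![0, 1, 0], ![0, -1, 0]) : (Fin 3 → k) × (Fin 3 → k)) := by
    have h2 := m1 (![0, 1, 0], ![0, -1, 0]) (by simp)
    have h3 := m3 (![0, 1, 0], ![0, -1, 0]) (by simp)
    generalize A (![0, 1, 0], ![0, -1, 0]) = q at h2 h3
    obtain ⟨x, z⟩ := q
    dsimp only at h2 h3
    subst h2
    have h31 := congrFun h3 0
    have h32 := congrFun h3 2
    simp only [Matrix.cons_val] at h31 h32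
    refine ⟨x 1, ?_⟩
    ext j <;> fin_cases j <;> simp [half h31, half h32.symm]
  have e2 : ∃ l : k, A (![0, 0, 1], ![0, 0, -1]) =
      l • ((![0, 0, 1], ![0, 0, -1]) : (Fin 3 → k) × (Fin 3 → k)) := by
    have h2 := m1 (![0, 0, 1], ![0, 0, -1]) (by simp)
    have h3 := m2 (![0, 0, 1], ![0, 0, -1]) (by simp)
    generalize A (![0, 0, 1], ![0, 0, -1]) = q at h2 h3
    obtain ⟨x, z⟩ := q
    dsimp only at h2 h3
    subst h2
    have h31 := congrFun h3 0
    have h32 := congrFun h3 1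
    simp only [Matrix.cons_val] at h31 h32
    refine ⟨x 2, ?_⟩
    ext j <;> fin_cases j <;> simp [half h31, half h32.symm]
  obtain ⟨l0, e0⟩ := e0
  obtain ⟨l1, e1⟩ := e1
  obtain ⟨l2, e2⟩ := e2
  have hanti : ∀ u : Fin 3 → k, A (u, -u) =
      (![l0 * u 0, l1 * u 1, l2 * u 2], ![-(l0 * u 0), -(l1 * u 1), -(l2 * u 2)]) := by
    intro u
    have : (u, -u) = u 0 • ((![1, 0, 0], ![-1, 0, 0]) : (Fin 3 → k) × (Fin 3 → k)) +
        u 1 • (![0, 1, 0], ![0, -1, 0]) + u 2 • (![0, 0, 1], ![0, 0, -1]) := by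
      ext j <;> fin_cases j <;> simp
    rw [this, map_add, map_add, map_smul, map_smul, map_smul, e0, e1, e2]
    ext j <;> fin_cases j <;> simp [mul_comm]
  -- Twice a vector is the sum of a diagonal and an antidiagonal one, which avoids dividing by 2.
  have hdecomp : ∀ x z : Fin 3 → k, A ((2 : k) • (x, z)) =
      c • (x + z, x + z) + A (x - z, -(x - z)) := by
    intro x z
    rw [← hc, ← map_add]
    congr 1
    ext j <;> simp <;> ring
  -- Preservation of the graphs of two transpositions makes the three antidiagonal eigenvalues
  -- equal.
  have h01 : l0 = l1 := by
    have := m4 ((2 : k) • (![1, 0, 0], ![0, 1, 0])) (by ext j; fin_cases j <;> simp)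
    rw [hdecomp, hanti] at this
    simpa using congrFun this 0
  have h12 : l1 = l2 := by
    have := m5 ((2 : k) • (![0, 1, 0], ![0, 0, 1])) (by ext j; fin_cases j <;> simp)
    rw [hdecomp, hanti] at this
    simpa using congrFun this 1
  subst h01 h12
  have hanti' : ∀ u : Fin 3 → k, A (u, -u) = l0 • (u, -u) := by
    intro u
    rw [hanti]
    ext j <;> fin_cases j <;> simp
  have hhalf : ∀ x z w, A ((2 : k) • (x, z)) = (2 : k) • w → A (x, z) = w := by
    intro x z w h
    rw [map_smul] at h
    exact smul_right_injective _ (two_ne_zero (α := k)) h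
  -- The graph of a 3-cycle goes to itself or to the graph of the inverse cycle. The first case
  -- gives a scalar, the second the eigenvalue -c on the antidiagonal, that is, the exchange of x
  -- and z.
  have hl : l0 = c ∨ l0 = -c := by
    have m6 := hπ (swap 1 2 * swap 2 3)
    have hρ : π (swap 1 2 * swap 2 3) = swap 1 2 * swap 2 3 ∨
        π (swap 1 2 * swap 2 3) = swap 2 3 * swap 1 2 := by
      have hx : ∀ a b : Fin 4, a ≠ b → swap 1 2 * swap 2 3 ≠ swap a b →
          π (swap 1 2 * swap 2 3) ≠ swap a b := fun a b hab h h' =>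
        h (hπinj (h'.trans (hswap a b hab).symm))
      exact eq_cycle_of_fixes _ (hne (by decide)) (hx 1 2 (by decide) (by decide))
        (hx 2 3 (by decide) (by decide)) (hx 1 3 (by decide) (by decide))
        (hfix' _ 0 (by decide))
    have m7 := m6 ((2 : k) • (![1, 0, 0], ![0, 1, 0])) (by
      rw [mem_graphPlane, ← tet_mulVec_mulVec, tet_swap_two_three, tet_swap_one_two]
      ext j; fin_cases j <;> simp)
    rw [hdecomp, hanti'] at m7
    rcases hρ with hρ | hρ
    · rw [hρ, mem_graphPlane, ← tet_mulVec_mulVec, tet_swap_two_three, tet_swap_one_two] at m7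
      have : 0 = c + -l0 := by simpa using congrFun m7 2
      exact Or.inl (by linear_combination this)
    · rw [hρ, mem_graphPlane, ← tet_mulVec_mulVec, tet_swap_two_three, tet_swap_one_two] at m7
      have : 0 = c + l0 := by simpa using congrFun m7 2
      exact Or.inr (by linear_combination -this)
  rcases hl with rfl | rfl
  · left
    intro x z
    apply hhalf
    rw [hdecomp, hanti']
    ext j <;> simp <;> ring
  · right
    intro x z
    apply hhalf
    rw [hdecomp, hanti']
    ext j <;> simp <;> ring

/-- A pair of elements of the tetrahedral group, acting on the two coordinate spaces. -/
def tetProd (k : Type*) [Field k] [NeZero (2 : k)] (s t : Perm (Fin 4)) :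
    ((Fin 3 → k) × (Fin 3 → k)) →ₗ[k] (Fin 3 → k) × (Fin 3 → k) :=
  LinearMap.prodMap (tet k s).mulVecLin (tet k t).mulVecLin

theorem tetProd_apply (s t : Perm (Fin 4)) (p : (Fin 3 → k) × (Fin 3 → k)) :
    tetProd k s t p = ((tet k s).mulVec p.1, (tet k t).mulVec p.2) := rfl

theorem tetProd_tetProd (s t s' t' : Perm (Fin 4)) (p : (Fin 3 → k) × (Fin 3 → k)) :
    tetProd k s t (tetProd k s' t' p) = tetProd k (s * s') (t * t') p := by
  simp only [tetProd_apply, tet_mulVec_mulVec]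

theorem tetProd_one (p : (Fin 3 → k) × (Fin 3 → k)) : tetProd k 1 1 p = p := by
  simp [tetProd_apply]

theorem tetProd_injective (s t : Perm (Fin 4)) : Function.Injective (tetProd k s t) :=
  Function.LeftInverse.injective (g := tetProd k s⁻¹ t⁻¹) fun p => by
    rw [tetProd_tetProd, inv_mul_cancel, inv_mul_cancel, tetProd_one]

/-- The pair (s, t) sends (x, r x) to (s x, t r x): on graphs it acts by left and right
multiplication. -/
theorem tetProd_mem_graphPlane {s t r : Perm (Fin 4)} {p : (Fin 3 → k) × (Fin 3 → k)}
    (hp : p ∈ graphPlane k r) : tetProd k s t p ∈ graphPlane k (t * r * s⁻¹) := by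
  rw [mem_graphPlane] at hp ⊢
  rw [tetProd_apply, hp, tet_mulVec_mulVec, tet_mulVec_mulVec, inv_mul_cancel_right]

theorem PermutesPlanes.tetProd_comp (hP : PermutesPlanes A) (s t : Perm (Fin 4)) :
    PermutesPlanes (tetProd k s t ∘ₗ A) := by
  intro r
  obtain ⟨r', hr⟩ := hP r
  exact ⟨t * r' * s⁻¹, fun p hp => tetProd_mem_graphPlane (hr p hp)⟩

/-- The linear transformations that permute the planes. -/
theorem exists_eq_smul_tetProd (hA : Function.Injective A) (hP : PermutesPlanes A) :
    ∃ (c : k) (s t : Perm (Fin 4)), (∀ p, A p = c • tetProd k s t p) ∨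
      ∀ p, A p = c • tetProd k s t p.swap := by
  obtain ⟨t, ht⟩ := hP 1
  -- Composing with (1, t⁻¹) returns the image of the diagonal to the diagonal; a further (s⁻¹, s⁻¹)
  -- makes the action there a scalar.
  obtain ⟨c, s, hs⟩ := exists_tet_of_preserves_diag (A := tetProd k 1 t⁻¹ ∘ₗ A)
    ((tetProd_injective _ _).comp hA) (hP.tetProd_comp _ _) (fun p hp => by
      simpa using tetProd_mem_graphPlane (s := 1) (t := t⁻¹) (ht p hp))
  have hP' := hP.tetProd_comp s⁻¹ (s⁻¹ * t⁻¹)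
  have hback : ∀ p, A p = tetProd k s (t * s) ((tetProd k s⁻¹ (s⁻¹ * t⁻¹) ∘ₗ A) p) := by
    intro p
    rw [LinearMap.comp_apply, tetProd_tetProd]
    simp [mul_assoc, tetProd_one]
  have hc : ∀ u, (tetProd k s⁻¹ (s⁻¹ * t⁻¹) ∘ₗ A) (u, u) = c • (u, u) := by
    intro u
    have h1 : (tetProd k s⁻¹ (s⁻¹ * t⁻¹) ∘ₗ A) (u, u) =
        tetProd k s⁻¹ s⁻¹ ((tetProd k 1 t⁻¹ ∘ₗ A) (u, u)) := by
      rw [LinearMap.comp_apply, LinearMap.comp_apply, tetProd_tetProd, mul_one]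
    rw [h1, hs, map_smul, tetProd_apply]
    simp only [tet_mulVec_mulVec, inv_mul_cancel, tet_one_mulVec]
  refine ⟨c, s, t * s, ?_⟩
  rcases eq_smul_or_eq_smul_swap
    (A := tetProd k s⁻¹ (s⁻¹ * t⁻¹) ∘ₗ A) ((tetProd_injective _ _).comp hA) hP' hc with h | h
  · left
    rintro ⟨x, z⟩
    rw [hback, h, map_smul]
  · right
    rintro ⟨x, z⟩
    rw [hback, h, map_smul]
    rfl

end Rigidity

/-! ### The automorphism group of the Humbert complex -/

section Action

open Equiv

variable {k : Type*} [Field k]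

theorem smul_eq_mulVec (g : GL KIdx k) (v : KIdx → k) : g • v = g.val.mulVec v := rfl

theorem setOf_submodule_le_injective {W W' : Submodule k (KIdx → k)}
    (h : {P : ℙ k (KIdx → k) | P.submodule ≤ W} = {P | P.submodule ≤ W'}) : W = W' := by
  ext v
  by_cases hv : v = 0
  · simp [hv]
  have := Set.ext_iff.mp h (Projectivization.mk k v hv)
  simpa [Projectivization.submodule_mk, Submodule.span_singleton_le_iff_mem] using this

variable {i : k} (hi : i ^ 2 = -1)

/-- The point with coordinates `(x, z)`. -/
def point (p : (Fin 3 → k) × (Fin 3 → k)) (hp : p ≠ 0) : ℙ k (KIdx → k) :=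
  Projectivization.mk k (kvec hi p) ((kvec hi).map_ne_zero_iff.mpr hp)

theorem exists_eq_point (P : ℙ k (KIdx → k)) : ∃ p hp, P = point hi p hp := by
  induction P using Projectivization.ind with
  | h v hv =>
    refine ⟨(kvec hi).symm v, (kvec hi).symm.map_ne_zero_iff.mpr hv, ?_⟩
    simp [point]

theorem point_eq_point_iff {p q : (Fin 3 → k) × (Fin 3 → k)} {hp : p ≠ 0} {hq : q ≠ 0} :
    point hi p hp = point hi q hq ↔ ∃ c : k, c • q = p := by
  rw [point, point, Projectivization.mk_eq_mk_iff']
  simp only [← map_smul, (kvec hi).injective.eq_iff]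

theorem point_submodule {p : (Fin 3 → k) × (Fin 3 → k)} (hp : p ≠ 0) :
    (point hi p hp).submodule = Submodule.span k {kvec hi p} :=
  Projectivization.submodule_mk _ _

theorem eq_point_of_submodule_eq {P : ℙ k (KIdx → k)} {p : (Fin 3 → k) × (Fin 3 → k)} (hp : p ≠ 0)
    (h : P.submodule = Submodule.span k {kvec hi p}) : P = point hi p hp :=
  Projectivization.submodule_injective (h.trans (point_submodule hi hp).symm)

/-- The linear transformation of the coordinates `(x, z)` given by a matrix. -/
def pairMap (g : GL KIdx k) : ((Fin 3 → k) × (Fin 3 → k)) →ₗ[k] (Fin 3 → k) × (Fin 3 → k) :=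
  (kvec hi).symm.toLinearMap ∘ₗ g.val.mulVecLin ∘ₗ (kvec hi).toLinearMap

theorem kvec_pairMap (g : GL KIdx k) (p : (Fin 3 → k) × (Fin 3 → k)) :
    kvec hi (pairMap hi g p) = g • kvec hi p := by
  simp [pairMap, smul_eq_mulVec]

theorem pairMap_mul (g h : GL KIdx k) (p : (Fin 3 → k) × (Fin 3 → k)) :
    pairMap hi (g * h) p = pairMap hi g (pairMap hi h p) := by
  apply (kvec hi).injective
  rw [kvec_pairMap, kvec_pairMap, kvec_pairMap, mul_smul]

theorem pairMap_one (p : (Fin 3 → k) × (Fin 3 → k)) : pairMap hi 1 p = p := by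
  apply (kvec hi).injective
  rw [kvec_pairMap, one_smul]

theorem pairMap_injective (g : GL KIdx k) : Function.Injective (pairMap hi g) :=
  Function.LeftInverse.injective (g := pairMap hi g⁻¹) fun p => by
    rw [← pairMap_mul, inv_mul_cancel, pairMap_one]

theorem pairMap_ne_zero (g : GL KIdx k) {p : (Fin 3 → k) × (Fin 3 → k)} (hp : p ≠ 0) :
    pairMap hi g p ≠ 0 :=
  (map_ne_zero_iff _ (pairMap_injective hi g)).mpr hp

theorem mk_smul_point (g : GL KIdx k) {p : (Fin 3 → k) × (Fin 3 → k)} (hp : p ≠ 0) :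
    Matrix.ProjGenLinGroup.mk g • point hi p hp =
      point hi (pairMap hi g p) (pairMap_ne_zero hi g hp) := by
  rw [point, Projectivization.PGL.mk_smul_mk, point]
  congr 1
  exact (kvec_pairMap hi g p).symm

theorem mk_eq_mk_iff_pairMap {g h : GL KIdx k} :
    Matrix.ProjGenLinGroup.mk g = Matrix.ProjGenLinGroup.mk h ↔
      ∃ c : k, ∀ p, pairMap hi g p = c • pairMap hi h p := by
  rw [eq_comm, Matrix.ProjGenLinGroup.mk_eq_mk_iff]
  have key : ∀ u : kˣ, ∀ v : KIdx → k,
      (h * Matrix.GeneralLinearGroup.scalar KIdx u) • v = (u : k) • h • v := by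
    intro u v
    rw [mul_smul, smul_eq_mulVec (Matrix.GeneralLinearGroup.scalar KIdx u)]
    rw [show (Matrix.GeneralLinearGroup.scalar KIdx u).val.mulVec v = (u : k) • v by
      simp [Matrix.scalar_apply, ← Matrix.smul_one_eq_diagonal, Matrix.smul_mulVec]]
    rw [smul_eq_mulVec, smul_eq_mulVec, Matrix.mulVec_smul]
  constructor
  · rintro ⟨u, hu⟩
    refine ⟨u, fun p => (kvec hi).injective ?_⟩
    rw [map_smul, kvec_pairMap, kvec_pairMap, ← hu, key]
  · rintro ⟨c, hc⟩
    have hc0 : c ≠ 0 := by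
      rintro rfl
      have h1 : ((1, 0) : (Fin 3 → k) × (Fin 3 → k)) ≠ 0 := by
        intro h0
        simpa using congrFun (congrArg Prod.fst h0) 0
      exact pairMap_ne_zero hi g h1 (by rw [hc, zero_smul])
    refine ⟨Units.mk0 c hc0, Units.ext (Matrix.ext_of_mulVec_single fun j => ?_)⟩
    change (h * Matrix.GeneralLinearGroup.scalar KIdx (Units.mk0 c hc0)) • (Pi.single j 1 : KIdx → k) =
      g • (Pi.single j 1 : KIdx → k)
    rw [key]
    obtain ⟨p, hp⟩ := (kvec hi).surjective (Pi.single j 1)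
    rw [← hp, ← kvec_pairMap, ← kvec_pairMap, hc, map_smul]
    rfl

/-- With y = -i z, the map (x, y) ↦ (-y, x) is i times the exchange of x and z, hence projectively
the exchange itself. -/
theorem pairMap_g₀ (p : (Fin 3 → k) × (Fin 3 → k)) : pairMap hi (g₀ k) p = i • p.swap := by
  apply (kvec hi).injective
  rw [kvec_pairMap, kvec_apply, g₀_smul]
  ext (j | j)
  · simp [kvec_inl]
  · simp only [kvec_inr, Sum.elim_inr, Prod.smul_snd, Prod.snd_swap, Pi.smul_apply, smul_eq_mul]
    linear_combination p.1 j * hi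

variable [NeZero (2 : k)]

/-- The block diagonal matrices formed from pairs of elements of the tetrahedral group. -/
def tetBlock (k : Type*) [Field k] [NeZero (2 : k)] :
    Perm (Fin 4) × Perm (Fin 4) →* GL KIdx k :=
  MonoidHom.toHomUnits
    { toFun := fun n => Matrix.fromBlocks (tet k n.1) 0 0 (tet k n.2)
      map_one' := by simp
      map_mul' := fun n m => by simp [Matrix.fromBlocks_multiply] }

theorem tetBlock_smul (n : Perm (Fin 4) × Perm (Fin 4)) (x y : Fin 3 → k) :
    tetBlock k n • (Sum.elim x y : KIdx → k) =
      Sum.elim ((tet k n.1).mulVec x) ((tet k n.2).mulVec y) := by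
  change (Matrix.fromBlocks (tet k n.1) 0 0 (tet k n.2)).mulVec _ = _
  simp [Matrix.fromBlocks_mulVec]

theorem pairMap_tetBlock (n : Perm (Fin 4) × Perm (Fin 4)) (p : (Fin 3 → k) × (Fin 3 → k)) :
    pairMap hi (tetBlock k n) p = tetProd k n.1 n.2 p := by
  apply (kvec hi).injective
  rw [kvec_pairMap, kvec_apply, tetBlock_smul, kvec_apply, tetProd_apply, Matrix.mulVec_smul]

theorem range_mk_tetBlock :
    Set.range (fun n => Matrix.ProjGenLinGroup.mk (tetBlock k n)) = obviousSymmetries k := by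
  ext γ
  constructor
  · rintro ⟨⟨s, t⟩, rfl⟩
    obtain ⟨σ, ε, hε, hs⟩ := exists_signedPerm_of_perm s
    obtain ⟨τ, e, he, ht⟩ := exists_signedPerm_of_perm t
    refine ⟨tetBlock k (s, t), σ, τ, ε, e, hε, he, fun x y => ?_, rfl⟩
    rw [tetBlock_smul, tet_mulVec_eq_iff s σ ε hs, tet_mulVec_eq_iff t τ e ht]
  · rintro ⟨g, σ, τ, ε, e, hε, he, hg, rfl⟩
    obtain ⟨s, hs⟩ := exists_vertexSign_of_signedPerm σ ε hε
    obtain ⟨t, ht⟩ := exists_vertexSign_of_signedPerm τ e he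
    refine ⟨(s, t), congrArg _ (Units.ext (Matrix.ext_of_mulVec_single fun j => ?_))⟩
    change tetBlock k (s, t) • (Pi.single j 1 : KIdx → k) = g • (Pi.single j 1 : KIdx → k)
    rw [← Sum.elim_comp_inl_inr (Pi.single j 1), hg, tetBlock_smul, tet_mulVec_eq_iff s σ ε hs,
      tet_mulVec_eq_iff t τ e ht]

theorem point_mem_humbertComplex_iff {p : (Fin 3 → k) × (Fin 3 → k)} (hp : p ≠ 0) :
    point hi p hp ∈ humbertComplex i ↔ HumbertEqs p :=
  mk_mem_humbertComplex_iff hi p _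

theorem mk_mem_projectiveAut_iff {g : GL KIdx k} :
    Matrix.ProjGenLinGroup.mk g ∈ projectiveAut (humbertComplex i) ↔
      ∀ p, HumbertEqs (pairMap hi g p) ↔ HumbertEqs p := by
  rw [MulAction.mem_stabilizer_set]
  constructor
  · intro h p
    by_cases hp : p = 0
    · simp [hp]
    have := h (point hi p hp)
    rwa [mk_smul_point, point_mem_humbertComplex_iff, point_mem_humbertComplex_iff] at this
  · intro h P
    obtain ⟨p, hp, rfl⟩ := exists_eq_point hi P
    rw [mk_smul_point, point_mem_humbertComplex_iff, point_mem_humbertComplex_iff, h]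

/-- The plane of the Humbert complex given by an element of the tetrahedral group. -/
def planeSet (s : Perm (Fin 4)) : Set (ℙ k (KIdx → k)) :=
  {P | P.submodule ≤ (graphPlane k s).map (kvec hi).toLinearMap}

theorem point_mem_planeSet_iff {p : (Fin 3 → k) × (Fin 3 → k)} (hp : p ≠ 0) {s : Perm (Fin 4)} :
    point hi p hp ∈ planeSet hi s ↔ p ∈ graphPlane k s := by
  change (point hi p hp).submodule ≤ _ ↔ _
  rw [point_submodule, Submodule.span_singleton_le_iff_mem]
  constructor
  · rintro ⟨q, hq, hqp⟩
    rwa [← (kvec hi).injective hqp]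
  · intro h
    exact ⟨p, h, rfl⟩

theorem planeSet_injective : Function.Injective (planeSet (k := k) hi) := by
  intro s t h
  exact graphPlane_injective (k := k)
    (Submodule.map_injective_of_injective (kvec hi).injective (setOf_submodule_le_injective h))

theorem planesIn_humbertComplex [Infinite k] :
    planesIn (humbertComplex i) = Set.range (planeSet hi) := by
  ext E
  constructor
  · rintro ⟨hE, W, hW, rfl⟩
    have hWE : ∀ p ∈ W.map (kvec hi).symm.toLinearMap, HumbertEqs p := by
      rintro _ ⟨v, hv, rfl⟩
      by_cases hv0 : v = 0
      · simp [hv0, HumbertEqs]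
      have hv' : (kvec hi).symm v ≠ 0 := (kvec hi).symm.map_ne_zero_iff.mpr hv0
      refine (point_mem_humbertComplex_iff hi hv').mp (hE ?_)
      change (point hi _ hv').submodule ≤ W
      rw [point_submodule, Submodule.span_singleton_le_iff_mem]
      simpa using hv
    obtain ⟨s, hs⟩ := eq_graphPlane_of_humbertEqs
      (by rw [LinearEquiv.finrank_map_eq, hW]) hWE
    refine ⟨s, ?_⟩
    rw [planeSet, ← hs, ← Submodule.map_comp]
    simp
  · rintro ⟨s, rfl⟩
    refine ⟨fun P hP => ?_, _, ?_, rfl⟩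
    · obtain ⟨p, hp, rfl⟩ := exists_eq_point hi P
      rw [point_mem_planeSet_iff] at hP
      exact (point_mem_humbertComplex_iff hi hp).mpr (humbertEqs_of_mem_graphPlane hP)
    · rw [LinearEquiv.finrank_map_eq, finrank_graphPlane]

theorem exists_map_graphPlane_eq [Infinite k] {g : GL KIdx k}
    (hg : Matrix.ProjGenLinGroup.mk g ∈ projectiveAut (humbertComplex i)) (s : Perm (Fin 4)) :
    ∃ t, ∀ p, pairMap hi g p ∈ graphPlane k t ↔ p ∈ graphPlane k s := by
  rw [mk_mem_projectiveAut_iff hi] at hg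
  obtain ⟨t, ht⟩ := eq_graphPlane_of_humbertEqs (W := (graphPlane k s).map (pairMap hi g))
    (by rw [← (Submodule.equivMapOfInjective _ (pairMap_injective hi g) _).finrank_eq,
      finrank_graphPlane])
    (by
      rintro _ ⟨p, hp, rfl⟩
      exact (hg p).mpr (humbertEqs_of_mem_graphPlane hp))
  refine ⟨t, fun p => ?_⟩
  rw [← ht, Submodule.mem_map]
  exact ⟨fun ⟨q, hq, h⟩ => pairMap_injective hi g h ▸ hq, fun h => ⟨p, h, rfl⟩⟩

theorem exists_pairMap_eq [Infinite k] {g : GL KIdx k}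
    (hg : Matrix.ProjGenLinGroup.mk g ∈ projectiveAut (humbertComplex i)) :
    ∃ (c : k) (s t : Perm (Fin 4)), (∀ p, pairMap hi g p = c • tetProd k s t p) ∨
      ∀ p, pairMap hi g p = c • tetProd k s t p.swap :=
  exists_eq_smul_tetProd (pairMap_injective hi g) fun s =>
    (exists_map_graphPlane_eq hi hg s).imp fun _ ht p hp => (ht p).mpr hp

theorem mk_smul_planeSet {g : GL KIdx k} {s t : Perm (Fin 4)}
    (h : ∀ p, pairMap hi g p ∈ graphPlane k t ↔ p ∈ graphPlane k s) :
    Matrix.ProjGenLinGroup.mk g • planeSet hi s = planeSet hi t := by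
  ext P
  obtain ⟨P, rfl⟩ := MulAction.surjective (Matrix.ProjGenLinGroup.mk g) P
  change Matrix.ProjGenLinGroup.mk g • P ∈ _ ↔ Matrix.ProjGenLinGroup.mk g • P ∈ _
  rw [Set.smul_mem_smul_set_iff]
  obtain ⟨p, hp, rfl⟩ := exists_eq_point hi P
  rw [mk_smul_point, point_mem_planeSet_iff, point_mem_planeSet_iff, h]

end Action

/-! ### Tangent spaces -/

section Tangent

variable {k ι : Type*} [Field k] [Fintype ι]

/-- Chain rule for a polynomial restricted to a parametrized curve. -/
theorem derivative_aeval_mvPolynomial (g : ι → Polynomial k) (f : MvPolynomial ι k) :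
    Polynomial.derivative (MvPolynomial.aeval g f) =
      ∑ j, MvPolynomial.aeval g (MvPolynomial.pderiv j f) * Polynomial.derivative (g j) := by
  classical
  induction f using MvPolynomial.induction_on with
  | C a => simp
  | add p q hp hq => simp only [map_add, hp, hq, add_mul, Finset.sum_add_distrib]
  | mul_X p n hp =>
    have h : ∀ j, MvPolynomial.aeval g (MvPolynomial.pderiv j (p * MvPolynomial.X n)) *
        Polynomial.derivative (g j) = MvPolynomial.aeval g (MvPolynomial.pderiv j p) *
        Polynomial.derivative (g j) * g n + (if n = j then
          MvPolynomial.aeval g p * Polynomial.derivative (g j) else 0) := by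
      intro j
      rw [MvPolynomial.pderiv_mul, MvPolynomial.pderiv_X, map_add, map_mul, map_mul,
        MvPolynomial.aeval_X]
      by_cases hj : n = j
      · subst hj
        simp
        ring
      · simp [hj]
        ring
    simp only [h, Finset.sum_add_distrib, ← Finset.sum_mul, ← hp]
    simp [Polynomial.derivative_mul]

/-- A linear subspace contained in `X` and passing through `P` lies in the tangent space at `P`. -/
theorem le_coneTangentSpace [Infinite k] {X : Set (ℙ k (ι → k))} {P : ℙ k (ι → k)}
    {W : Submodule k (ι → k)} (hW : {Q : ℙ k (ι → k) | Q.submodule ≤ W} ⊆ X)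
    (hP : P.submodule ≤ W) : W ≤ coneTangentSpace X P := by
  intro w hw d f _ hf
  have hrep : P.rep ∈ W := hP (by
    rw [Projectivization.submodule_eq]; exact Submodule.mem_span_singleton_self _)
  let g : ι → Polynomial k := fun j => .C (P.rep j) + .C (w j) * .X
  have heval : ∀ (t : k) (q : MvPolynomial ι k), Polynomial.eval t (MvPolynomial.aeval g q) =
      MvPolynomial.eval (P.rep + t • w) q := by
    intro t q
    induction q using MvPolynomial.induction_on with
    | C a => simp
    | add p q hp hq => simp only [map_add, Polynomial.eval_add, hp, hq]
    | mul_X p n hp =>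
      simp only [map_mul, Polynomial.eval_mul, hp, MvPolynomial.aeval_X, MvPolynomial.eval_X]
      simp [g, mul_comm t]
  -- The form f vanishes along the line P + t w except possibly where this vector is zero, which
  -- happens for at most one t. The derivative at t = 0 is the required differential.
  have hzero : MvPolynomial.aeval g f = 0 := by
    apply Polynomial.eq_zero_of_infinite_isRoot
    have hfin : {t : k | P.rep + t • w = 0}.Finite := by
      refine Set.Subsingleton.finite fun t ht t' ht' => ?_
      have h1 : (t - t') • w = 0 := by
        rw [sub_smul, sub_eq_zero]
        exact add_left_cancel (Eq.trans ht (Eq.symm ht'))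
      rcases smul_eq_zero.mp h1 with h | h
      · exact sub_eq_zero.mp h
      · exact absurd (by simpa [h] using (show P.rep + t • w = 0 from ht)) P.rep_nonzero
    refine Set.Infinite.mono (fun t ht => ?_) hfin.infinite_compl
    change Polynomial.eval t _ = 0
    rw [heval]
    refine hf _ ht (hW ?_)
    change (Projectivization.mk k _ _).submodule ≤ W
    rw [Projectivization.submodule_mk, Submodule.span_singleton_le_iff_mem]
    exact W.add_mem hrep (W.smul_mem t hw)
  have h := congrArg (Polynomial.eval 0) (derivative_aeval_mvPolynomial g f)
  rw [hzero, Polynomial.derivative_zero, Polynomial.eval_zero, Polynomial.eval_finsetSum] at h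
  rw [h]
  refine Finset.sum_congr rfl fun j _ => ?_
  rw [Polynomial.eval_mul, heval, zero_smul, add_zero]
  simp [g]

end Tangent

/-! ### Bounds for the tangent spaces of the Humbert complex -/

section SingularPoints

open Equiv

variable {k : Type*} [Field k]

theorem five_le_finrank_of_ker_le {T : Submodule k ((Fin 3 → k) × (Fin 3 → k))}
    (θ : (Fin 3 → k) × (Fin 3 → k) →ₗ[k] k) (h : ∀ p, θ p = 0 → p ∈ T) :
    5 ≤ Module.finrank k T := by
  have h1 := LinearMap.finrank_range_add_finrank_ker θ
  have h2 : Module.finrank k (LinearMap.range θ) ≤ 1 :=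
    (Submodule.finrank_le _).trans (Module.finrank_self k).le
  have h3 : Module.finrank k (LinearMap.ker θ) ≤ Module.finrank k T :=
    Submodule.finrank_mono fun p hp => h p hp
  have h4 : Module.finrank k ((Fin 3 → k) × (Fin 3 → k)) = 6 := by simp
  omega

/-- Uses the identity (∑ αₘvₘ, ∑ βₙvₙ) = ∑ αₘ(vₘ, v_{n₀}) + ∑ βₙ(v_{m₀}, vₙ) - (∑ αₘ)(v_{m₀},
v_{n₀}). -/
theorem sum_smul_vertex_mem {T : Submodule k ((Fin 3 → k) × (Fin 3 → k))} {M N : Finset (Fin 4)}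
    (hM : M.Nonempty) (hN : N.Nonempty)
    (hT : ∀ m ∈ M, ∀ n ∈ N, (vertex k m, vertex k n) ∈ T) {α β : Fin 4 → k}
    (h : ∑ m ∈ M, α m = ∑ n ∈ N, β n) :
    (∑ m ∈ M, α m • vertex k m, ∑ n ∈ N, β n • vertex k n) ∈ T := by
  obtain ⟨m₀, hm₀⟩ := hM
  obtain ⟨n₀, hn₀⟩ := hN
  have h1 : ∑ m ∈ M, α m • (vertex k m, vertex k n₀) ∈ T :=
    T.sum_mem fun m hm => T.smul_mem _ (hT m hm n₀ hn₀)
  have h2 : ∑ n ∈ N, β n • (vertex k m₀, vertex k n) ∈ T :=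
    T.sum_mem fun n hn => T.smul_mem _ (hT m₀ hm₀ n hn)
  have h3 : (∑ m ∈ M, α m) • (vertex k m₀, vertex k n₀) ∈ T := T.smul_mem _ (hT m₀ hm₀ n₀ hn₀)
  convert T.sub_mem (T.add_mem h1 h2) h3 using 1
  ext1
  · simp [Prod.fst_sum, ← Finset.sum_smul, h]
  · simp [Prod.snd_sum, ← Finset.sum_smul]

theorem exists_perm_map_pair : ∀ a b c d : Fin 4, a ≠ c → b ≠ d →
    ∃ s : Perm (Fin 4), s a = b ∧ s c = d := by
  decide +kernel

theorem exists_perm_block : ∀ a b c d : Fin 4, a ≠ b → c ≠ d → ∀ m n : Fin 4,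
    (m ∈ ({a, b} : Finset (Fin 4)) ↔ n ∈ ({c, d} : Finset (Fin 4))) →
    ∃ s : Perm (Fin 4), (s a = c ∧ s b = d ∨ s a = d ∧ s b = c) ∧ s m = n := by
  decide +kernel

theorem finrank_coneTangentSpace {i : k} (hi : i ^ 2 = -1)
    (P : ℙ k (KIdx → k)) :
    Module.finrank k (coneTangentSpace (humbertComplex i) P) =
      Module.finrank k ((coneTangentSpace (humbertComplex i) P).comap (kvec hi).toLinearMap) := by
  rw [Submodule.comap_equiv_eq_map_symm, LinearEquiv.finrank_map_eq]

/-- The quadric containing the Humbert complex. -/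
noncomputable def quadricForm (k : Type*) [Field k] : MvPolynomial KIdx k := ∑ j, MvPolynomial.X j ^ 2

/-- The cubic containing the Humbert complex. -/
noncomputable def cubicForm (i : k) : MvPolynomial KIdx k :=
  MvPolynomial.X (Sum.inl 0) * MvPolynomial.X (Sum.inl 1) * MvPolynomial.X (Sum.inl 2) +
    MvPolynomial.C i *
      (MvPolynomial.X (Sum.inr 0) * MvPolynomial.X (Sum.inr 1) * MvPolynomial.X (Sum.inr 2))

theorem quadricForm_isHomogeneous : (quadricForm k).IsHomogeneous 2 :=
  MvPolynomial.IsHomogeneous.sum _ _ _ fun j _ => MvPolynomial.isHomogeneous_X_pow j 2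

theorem cubicForm_isHomogeneous (i : k) : (cubicForm i).IsHomogeneous 3 := by
  have h : ∀ a b c : KIdx, (MvPolynomial.X a * MvPolynomial.X b * MvPolynomial.X c :
      MvPolynomial KIdx k).IsHomogeneous 3 := fun a b c =>
    ((MvPolynomial.isHomogeneous_X k a).mul (MvPolynomial.isHomogeneous_X k b)).mul
      (MvPolynomial.isHomogeneous_X k c)
  refine (h _ _ _).add ?_
  simpa using (MvPolynomial.isHomogeneous_C KIdx i).mul (h (Sum.inr 0) (Sum.inr 1) (Sum.inr 2))

/-- A subspace of dimension at least 5 killed by a nonzero functional on a 6-dimensional space is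
its kernel, so a second functional killing it is a multiple of the first. -/
theorem eq_smul_of_polarForm_eq_zero {T : Submodule k ((Fin 3 → k) × (Fin 3 → k))}
    {q q' : (Fin 3 → k) × (Fin 3 → k)} (hq : q ≠ 0) (hT : 5 ≤ Module.finrank k T)
    (h : ∀ r ∈ T, polarForm k q r = 0 ∧ polarForm k q' r = 0) : ∃ c : k, q' = c • q := by
  have hf : polarForm k q ≠ 0 := fun h0 =>
    hq (polarForm_nondegenerate.1 q fun r => LinearMap.congr_fun h0 r)
  have hrange : LinearMap.range (polarForm k q) = ⊤ := LinearMap.range_eq_top.mpr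
    (LinearMap.surjective hf)
  have h1 := LinearMap.finrank_range_add_finrank_ker (polarForm k q)
  have h4 : Module.finrank k ((Fin 3 → k) × (Fin 3 → k)) = 6 := by simp
  rw [hrange, finrank_top, Module.finrank_self, h4] at h1
  have hTker : T = LinearMap.ker (polarForm k q) :=
    Submodule.eq_of_le_of_finrank_le (fun r hr => (h r hr).1) (by omega)
  obtain ⟨c, hc⟩ := exists_smul_of_ker_le (f := polarForm k q) (g := polarForm k q')
    fun r hr => (h r (hTker ▸ hr)).2
  refine ⟨c, sub_eq_zero.mp (polarForm_nondegenerate.1 _ fun r => ?_)⟩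
  rw [map_sub, map_smul, LinearMap.sub_apply, LinearMap.smul_apply, hc, smul_eq_mul, sub_self]

variable [NeZero (2 : k)]

theorem vertex_pair_mem_graphPlane {s : Perm (Fin 4)} (a : Fin 4) :
    (vertex k a, vertex k (s a)) ∈ graphPlane k s :=
  mem_graphPlane.mpr (tet_mulVec_vertex s a).symm

/-- The graphs through (v_a, v_b) contain all (v_m, v_n) with m ≠ a and n ≠ b, and these span the
whole polar hyperplane of the point. -/
theorem five_le_finrank_vertex {T : Submodule k ((Fin 3 → k) × (Fin 3 → k))} (a b : Fin 4)
    (hT : ∀ s, (vertex k a, vertex k b) ∈ graphPlane k s → graphPlane k s ≤ T) :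
    5 ≤ Module.finrank k T := by
  have hT' : ∀ m ∈ Finset.univ.erase a, ∀ n ∈ Finset.univ.erase b,
      (vertex k m, vertex k n) ∈ T := by
    intro m hm n hn
    obtain ⟨s, rfl, rfl⟩ := exists_perm_map_pair a b m n (Finset.ne_of_mem_erase hm).symm
      (Finset.ne_of_mem_erase hn).symm
    exact hT s (vertex_pair_mem_graphPlane a) (vertex_pair_mem_graphPlane m)
  have hne : ∀ a : Fin 4, (Finset.univ.erase a).Nonempty := by decide
  -- Subtracting a constant from the frame coefficients makes the one at a vanish and leaves the
  -- vector unchanged; the remaining ones then sum to -(v_a · x).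
  have key : ∀ (a : Fin 4) (x : Fin 3 → k),
      (∑ m ∈ Finset.univ.erase a, 4⁻¹ * (vertex k m ⬝ᵥ x - vertex k a ⬝ᵥ x) = -(vertex k a ⬝ᵥ x)) ∧
      ∑ m ∈ Finset.univ.erase a, (4⁻¹ * (vertex k m ⬝ᵥ x - vertex k a ⬝ᵥ x)) • vertex k m = x := by
    intro a x
    have h4 := four_ne_zero_of_two (k := k)
    constructor
    · rw [Finset.sum_erase _ (by simp), ← Finset.mul_sum, Finset.sum_sub_distrib,
        sum_vertex_dotProduct]
      simp [h4]
    · rw [Finset.sum_erase _ (by simp)]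
      conv_rhs => rw [eq_sum_vertex x]
      simp_rw [mul_sub, sub_smul, Finset.sum_sub_distrib, ← Finset.smul_sum, sum_vertex]
      simp
  refine five_le_finrank_of_ker_le
    (polarForm k (vertex k a, vertex k b)) ?_
  rintro ⟨x, z⟩ h
  have h' : vertex k a ⬝ᵥ x = vertex k b ⬝ᵥ z := sub_eq_zero.mp h
  rw [← (key a x).2, ← (key b z).2]
  refine sum_smul_vertex_mem (hne a) (hne b) hT' ?_
  rw [(key a x).1, (key b z).1, h']

/-- The graphs of the s carrying {a, b} to {c, d} contain (v_m, v_n) whenever m and n lie both in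
these pairs or both in the complements. A vector of the polar hyperplane splits accordingly into two
sums with matching coefficient totals. -/
theorem five_le_finrank_edge {T : Submodule k ((Fin 3 → k) × (Fin 3 → k))} {a b c d : Fin 4}
    (hab : a ≠ b) (hcd : c ≠ d)
    (hT : ∀ s, (vertex k a + vertex k b, vertex k c + vertex k d) ∈ graphPlane k s →
      graphPlane k s ≤ T) :
    5 ≤ Module.finrank k T := by
  have hT' : ∀ m n, (m ∈ ({a, b} : Finset (Fin 4)) ↔ n ∈ ({c, d} : Finset (Fin 4))) →
      (vertex k m, vertex k n) ∈ T := by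
    intro m n hmn
    obtain ⟨s, h, rfl⟩ := exists_perm_block a b c d hab hcd m n hmn
    refine hT s ?_ (vertex_pair_mem_graphPlane m)
    rcases h with ⟨rfl, rfl⟩ | ⟨rfl, rfl⟩
    · exact (graphPlane k s).add_mem (vertex_pair_mem_graphPlane a) (vertex_pair_mem_graphPlane b)
    · rw [add_comm (vertex k (s b))]
      exact (graphPlane k s).add_mem (vertex_pair_mem_graphPlane a) (vertex_pair_mem_graphPlane b)
  have hne : ∀ a b : Fin 4, ({a, b} : Finset (Fin 4))ᶜ.Nonempty := by decide
  refine five_le_finrank_of_ker_le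
    (polarForm k (vertex k a + vertex k b, vertex k c + vertex k d)) ?_
  rintro ⟨x, z⟩ h
  have h' : (vertex k a + vertex k b) ⬝ᵥ x = (vertex k c + vertex k d) ⬝ᵥ z := sub_eq_zero.mp h
  rw [add_dotProduct, add_dotProduct] at h'
  have hsum : ∑ m ∈ {a, b}, 4⁻¹ * (vertex k m ⬝ᵥ x) = ∑ n ∈ {c, d}, 4⁻¹ * (vertex k n ⬝ᵥ z) := by
    rw [← Finset.mul_sum, ← Finset.mul_sum, Finset.sum_pair hab, Finset.sum_pair hcd, h']
  have hsum' : ∑ m ∈ {a, b}ᶜ, 4⁻¹ * (vertex k m ⬝ᵥ x) =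
      ∑ n ∈ {c, d}ᶜ, 4⁻¹ * (vertex k n ⬝ᵥ z) := by
    have h1 := Finset.sum_add_sum_compl {a, b} fun m => 4⁻¹ * (vertex k m ⬝ᵥ x)
    have h2 := Finset.sum_add_sum_compl {c, d} fun n => 4⁻¹ * (vertex k n ⬝ᵥ z)
    have h0 : ∀ u : Fin 3 → k, ∑ m, 4⁻¹ * (vertex k m ⬝ᵥ u) = 0 := fun u => by
      rw [← Finset.mul_sum, sum_vertex_dotProduct, mul_zero]
    rw [h0] at h1 h2
    linear_combination h1 - h2 - hsum
  have h1 := sum_smul_vertex_mem (Finset.insert_nonempty a {b}) (Finset.insert_nonempty c {d})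
    (fun m hm n hn => hT' m n (iff_of_true hm hn)) hsum
  have h2 := sum_smul_vertex_mem (hne a b) (hne c d)
    (fun m hm n hn => hT' m n (iff_of_false (Finset.mem_compl.mp hm) (Finset.mem_compl.mp hn)))
    hsum'
  have := T.add_mem h1 h2
  rwa [Prod.mk_add_mk, Finset.sum_add_sum_compl, Finset.sum_add_sum_compl, ← eq_sum_vertex,
    ← eq_sum_vertex] at this

theorem graphPlane_le_comap_coneTangentSpace [Infinite k] {i : k} (hi : i ^ 2 = -1)
    {p : (Fin 3 → k) × (Fin 3 → k)} (hp : p ≠ 0) {s : Perm (Fin 4)} (h : p ∈ graphPlane k s) :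
    graphPlane k s ≤
      (coneTangentSpace (humbertComplex i) (point hi p hp)).comap (kvec hi).toLinearMap := by
  rw [← Submodule.map_le_iff_le_comap]
  refine le_coneTangentSpace ?_ ((point_mem_planeSet_iff hi hp).mpr h)
  exact (planesIn_humbertComplex hi ▸ Set.mem_range_self s :
    planeSet hi s ∈ planesIn (humbertComplex i)).1

theorem humbertEqs_of_mem {i : k} (hi : i ^ 2 = -1) {v : KIdx → k} {hv : v ≠ 0}
    (h : Projectivization.mk k v hv ∈ humbertComplex i) : HumbertEqs ((kvec hi).symm v) := by
  rw [← mk_mem_humbertComplex_iff hi _ (by simpa using hv)]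
  simpa using h

theorem quadricForm_vanishesOn {i : k} (hi : i ^ 2 = -1) :
    VanishesOn (quadricForm k) (humbertComplex i) := by
  intro v hv h
  have := (humbertEqs_of_mem hi h).1
  simp only [kvec_symm_fst, kvec_symm_snd] at this
  simp only [quadricForm, map_sum, map_pow, MvPolynomial.eval_X]
  simp only [Fintype.sum_sum_type, Fin.sum_univ_three]
  linear_combination this + (v (Sum.inr 0) ^ 2 + v (Sum.inr 1) ^ 2 + v (Sum.inr 2) ^ 2) * hi

theorem cubicForm_vanishesOn {i : k} (hi : i ^ 2 = -1) :
    VanishesOn (cubicForm i) (humbertComplex i) := by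
  intro v hv h
  have := (humbertEqs_of_mem hi h).2
  simp only [kvec_symm_fst, kvec_symm_snd] at this
  simp only [cubicForm, map_add, map_mul, MvPolynomial.eval_X, MvPolynomial.eval_C]
  linear_combination this +
    i * (v (Sum.inr 0) * v (Sum.inr 1) * v (Sum.inr 2)) * hi

/-- The gradient of `x₀ x₁ x₂`. -/
def cofactors (x : Fin 3 → k) : Fin 3 → k := ![x 1 * x 2, x 0 * x 2, x 0 * x 1]

/-- Through the polar form, the differentials of the quadric (up to the factor 2) and of the cubic
are represented by q and by the pair of its cofactor vectors. -/
theorem polarForm_eq_zero_of_mem_coneTangentSpace {i : k} (hi : i ^ 2 = -1) {P : ℙ k (KIdx → k)}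
    {q r : (Fin 3 → k) × (Fin 3 → k)} (hq : P.rep = kvec hi q)
    (hr : kvec hi r ∈ coneTangentSpace (humbertComplex i) P) :
    polarForm k q r = 0 ∧ polarForm k (cofactors q.1, cofactors q.2) r = 0 := by
  have h1 := hr 2 _ quadricForm_isHomogeneous (quadricForm_vanishesOn hi)
  have h2 := hr 3 _ (cubicForm_isHomogeneous i) (cubicForm_vanishesOn hi)
  rw [hq] at h1 h2
  simp only [polarForm_apply, dotProduct, Fin.sum_univ_three, cofactors, Matrix.cons_val]
  constructor
  · have h3 : 2 * q.1 0 * r.1 0 + 2 * q.1 1 * r.1 1 + 2 * q.1 2 * r.1 2 +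
        (2 * (i * q.2 2) * (i * r.2 2) + (2 * (i * q.2 1) * (i * r.2 1) +
          2 * (i * q.2 0) * (i * r.2 0))) = 0 := by
      simpa [quadricForm, MvPolynomial.pderiv_X, Fin.sum_univ_three, Pi.single_apply, kvec_inl,
        kvec_inr, Fintype.sum_sum_type] using h1
    refine (mul_eq_zero.mp ?_).resolve_left (two_ne_zero (α := k))
    linear_combination h3 - 2 * (q.2 0 * r.2 0 + q.2 1 * r.2 1 + q.2 2 * r.2 2) * hi
  · have h3 : q.1 2 * q.1 1 * r.1 0 + q.1 2 * q.1 0 * r.1 1 + q.1 0 * q.1 1 * r.1 2 +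
        (-(i * (i * q.2 0 * (i * q.2 1)) * (i * r.2 2)) +
          (-(i * (i * q.2 2 * (i * q.2 0)) * (i * r.2 1)) +
            -(i * (i * q.2 2 * (i * q.2 1)) * (i * r.2 0)))) = 0 := by
      simpa [cubicForm, MvPolynomial.pderiv_X, Fin.sum_univ_three, Pi.single_apply, kvec_inl,
        kvec_inr, Fintype.sum_sum_type] using h2
    linear_combination h3 +
      (q.2 1 * q.2 2 * r.2 0 + q.2 0 * q.2 2 * r.2 1 + q.2 0 * q.2 1 * r.2 2) * (i ^ 2 - 1) * hi

/-- At a singular point the gradients of the two equations are dependent. -/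
theorem cofactors_eq_smul_of_singular {i : k} (hi : i ^ 2 = -1) {P : ℙ k (KIdx → k)}
    (hP : P ∈ singularPoints 3 (humbertComplex i)) :
    ∃ (q : (Fin 3 → k) × (Fin 3 → k)) (hq : q ≠ 0) (c : k), P = point hi q hq ∧ HumbertEqs q ∧
      cofactors q.1 = c • q.1 ∧ cofactors q.2 = c • q.2 := by
  obtain ⟨hPX, hT⟩ := hP
  have hq : (kvec hi).symm P.rep ≠ 0 := (kvec hi).symm.map_ne_zero_iff.mpr P.rep_nonzero
  have hPq : P = point hi _ hq := by simp [point]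
  rw [finrank_coneTangentSpace hi] at hT
  obtain ⟨c, hc⟩ := eq_smul_of_polarForm_eq_zero hq hT fun r hr =>
    polarForm_eq_zero_of_mem_coneTangentSpace hi ((kvec hi).apply_symm_apply _).symm hr
  refine ⟨_, hq, c, hPq, ?_, congrArg Prod.fst hc, congrArg Prod.snd hc⟩
  rw [hPq] at hPX
  exact (point_mem_humbertComplex_iff hi hq).mp hPX

end SingularPoints

/-! ### The singular points -/

section SingularSets

open Equiv

/-- The eight sign vectors are the vertices, with product 1, and their negatives. -/
theorem exists_vertexSign_eq : ∀ e : Fin 3 → ℤˣ,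
    ∃ a, ∀ j, (e j : ℤ) = (∏ l, e l : ℤˣ) * vertexSign a j := by
  decide +kernel

theorem prod_vertexSign : ∀ a, vertexSign a 0 * vertexSign a 1 * vertexSign a 2 = 1 := by
  decide

theorem vertexSign_sq : ∀ a j, vertexSign a j ^ 2 = 1 := by
  decide

/-- The midpoints of the six edges are the six vectors ±eⱼ. -/
theorem exists_vertexSign_add_eq_single : ∀ a b, a ≠ b →
    ∃ (j : Fin 3) (e : ℤˣ), vertexSign a + vertexSign b = Pi.single j (2 * (e : ℤ)) := by
  decide +kernel

theorem exists_single_eq_vertexSign_add : ∀ (j : Fin 3) (e : ℤˣ),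
    ∃ a b, a ≠ b ∧ vertexSign a + vertexSign b = Pi.single j (2 * (e : ℤ)) := by
  decide +kernel

variable {k : Type*} [Field k]

theorem vertex_add_eq_single {a b : Fin 4} {j : Fin 3} {e : ℤˣ}
    (h : vertexSign a + vertexSign b = Pi.single j (2 * (e : ℤ))) :
    vertex k a + vertex k b = (2 : k) • Pi.single j ((e : ℤ) : k) := by
  ext l
  have := congrArg (Int.cast : ℤ → k) (congrFun h l)
  simp only [Pi.add_apply, Int.cast_add] at this
  rw [Pi.add_apply, vertex, vertex, this, ← Pi.single_smul, Pi.single_apply, Pi.single_apply]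
  split_ifs <;> simp

theorem vertex_sq (a : Fin 4) (j : Fin 3) : vertex k a j ^ 2 = 1 := by
  rw [vertex, ← Int.cast_pow, vertexSign_sq, Int.cast_one]

theorem vertex_apply_ne_zero (a : Fin 4) (j : Fin 3) : vertex k a j ≠ 0 := fun h => by
  simpa [h] using vertex_sq (k := k) a j

theorem exists_units_of_sq_eq_one {c : k} (h : c ^ 2 = 1) : ∃ e : ℤˣ, ((e : ℤ) : k) = c := by
  rcases mul_self_eq_one_iff.mp ((sq c).symm.trans h) with h1 | h1
  · exact ⟨1, by simp [h1]⟩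
  · exact ⟨-1, by simp [h1]⟩

theorem units_cast_sq (e : ℤˣ) : ((e : ℤ) : k) ^ 2 = 1 := by
  rw [← Int.cast_pow, ← Units.val_pow_eq_pow_val, Int.units_sq]
  simp

theorem units_cast_ne_zero (e : ℤˣ) : ((e : ℤ) : k) ≠ 0 := fun h => by
  simpa [h] using units_cast_sq (k := k) e

theorem single_pair_ne_zero (j : Fin 3) (z : Fin 3 → k) :
    ((Pi.single j 1, z) : (Fin 3 → k) × (Fin 3 → k)) ≠ 0 := fun h => by
  simpa using congrFun (congrArg Prod.fst h) j

theorem vertex_pair_ne_zero (a b : Fin 4) :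
    ((vertex k a, vertex k b) : (Fin 3 → k) × (Fin 3 → k)) ≠ 0 := fun h =>
  vertex_ne_zero a (congrArg Prod.fst h)

variable {i : k} (hi : i ^ 2 = -1)

theorem ne_zero_of_sq_eq_neg_one {i : k} (hi : i ^ 2 = -1) : i ≠ 0 := by
  rintro rfl
  simp at hi

theorem mem_sing₁_iff {P : ℙ k (KIdx → k)} :
    P ∈ sing₁ k ↔ ∃ (j l : Fin 3) (e : ℤˣ),
      P = point hi (Pi.single j 1, Pi.single l ((e : ℤ) : k)) (single_pair_ne_zero j _) := by
  have hvec : ∀ (j l : Fin 3) (c : k),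
      kvec hi (Pi.single j 1, Pi.single l (i * c)) = Sum.elim (Pi.single j 1) (Pi.single l c) := by
    intro j l c
    rw [kvec_apply]
    congr 1
    rw [← Pi.single_smul, smul_eq_mul]
    congr 1
    linear_combination -c * hi
  constructor
  · rintro ⟨j, l, c, hc, hP⟩
    obtain ⟨e, he⟩ := exists_units_of_sq_eq_one (c := i * c)
      (by rw [mul_pow, hi, hc, neg_mul_neg, one_mul])
    refine ⟨j, l, e, eq_point_of_submodule_eq hi _ ?_⟩
    rw [hP, he, hvec]
  · rintro ⟨j, l, e, rfl⟩
    refine ⟨j, l, -i * (e : ℤ), ?_, ?_⟩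
    · rw [mul_pow, neg_pow_two, hi, units_cast_sq, mul_one]
    · rw [point_submodule, ← hvec]
      congr 6
      linear_combination ((e : ℤ) : k) * hi

/-- The entries of -iε and of e are signs, and the product condition says that both sign vectors
have the same product. That common sign can be scaled away, leaving a pair of vertices. -/
theorem mem_sing₂_iff {P : ℙ k (KIdx → k)} :
    P ∈ sing₂ i ↔ ∃ a b : Fin 4, P = point hi (vertex k a, vertex k b) (vertex_pair_ne_zero a b) := by
  have hi0 := ne_zero_of_sq_eq_neg_one hi
  constructor
  · rintro ⟨ε, e, hε, he, hprod, hP⟩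
    have hx : ∀ j, ∃ δ : ℤˣ, ((δ : ℤ) : k) = -i * ε j := fun j =>
      exists_units_of_sq_eq_one (by rw [mul_pow, neg_pow_two, hi, hε, neg_mul_neg, one_mul])
    have hz : ∀ j, ∃ δ : ℤˣ, ((δ : ℤ) : k) = e j := fun j => exists_units_of_sq_eq_one (he j)
    choose x hx using hx
    choose z hz using hz
    obtain ⟨a, ha⟩ := exists_vertexSign_eq x
    obtain ⟨b, hb⟩ := exists_vertexSign_eq z
    have hprod' : (((∏ l, x l : ℤˣ) : ℤ) : k) = ((∏ l, z l : ℤˣ) : ℤ) := by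
      simp only [Fin.prod_univ_three, Units.val_mul, Int.cast_mul, hx, hz]
      linear_combination -i ^ 3 * hprod + e 0 * e 1 * e 2 * (i ^ 2 - 1) * hi
    have hxa : ∀ j, -i * ε j = ((∏ l, z l : ℤˣ) : ℤ) * vertex k a j := fun j => by
      rw [← hx, ha, Int.cast_mul, hprod', vertex]
    have hzb : ∀ j, e j = ((∏ l, z l : ℤˣ) : ℤ) * vertex k b j := fun j => by
      rw [← hz, hb, Int.cast_mul, vertex]
    refine ⟨a, b, eq_point_of_submodule_eq hi _ ?_⟩
    have hc : i * (((∏ l, z l : ℤˣ) : ℤ) : k) ≠ 0 := mul_ne_zero hi0 (units_cast_ne_zero _)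
    symm
    rw [hP, ← Submodule.span_singleton_smul_eq (isUnit_iff_ne_zero.mpr hc)]
    congr 2
    ext (j | j)
    · simp only [Sum.elim_inl, Pi.smul_apply, smul_eq_mul, kvec_inl]
      linear_combination -i * hxa j - ε j * hi
    · simp only [Sum.elim_inr, Pi.smul_apply, smul_eq_mul, kvec_inr]
      linear_combination -hzb j - (((∏ l, z l : ℤˣ) : ℤ) : k) * vertex k b j * hi
  · rintro ⟨a, b, rfl⟩
    have hp : ∀ a, vertex k a 0 * vertex k a 1 * vertex k a 2 = 1 := fun a => by
      simp only [vertex]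
      rw [← Int.cast_mul, ← Int.cast_mul, prod_vertexSign, Int.cast_one]
    refine ⟨i • vertex k a, vertex k b, fun j => ?_, vertex_sq b, ?_, ?_⟩
    · rw [Pi.smul_apply, smul_eq_mul, mul_pow, hi, vertex_sq, mul_one]
    · simp only [Pi.smul_apply, smul_eq_mul]
      linear_combination i ^ 3 * hp a + i * hp b + i * hi
    · rw [point_submodule, ← Submodule.span_singleton_smul_eq (isUnit_iff_ne_zero.mpr hi0)]
      congr 2
      ext (j | j)
      · simp [kvec_inl]
      · simp only [Sum.elim_inr, Pi.smul_apply, smul_eq_mul, kvec_inr]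
        linear_combination -vertex k b j * hi

theorem disjoint_sing (hi : i ^ 2 = -1) : Disjoint (sing₁ k) (sing₂ i) := by
  rw [Set.disjoint_left]
  intro P h1 h2
  obtain ⟨j, l, e, rfl⟩ := (mem_sing₁_iff hi).mp h1
  obtain ⟨a, b, hab⟩ := (mem_sing₂_iff hi).mp h2
  obtain ⟨c, hc⟩ := (point_eq_point_iff hi).mp hab
  obtain ⟨m, hm⟩ := exists_ne j
  have h := congrFun (congrArg Prod.fst hc)
  have h3 := h m
  have h4 := h j
  simp only [Prod.smul_fst, Pi.smul_apply, smul_eq_mul, Pi.single_eq_of_ne hm, mul_eq_zero,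
    vertex_apply_ne_zero, or_false] at h3
  simp [h3] at h4

variable [NeZero (2 : k)]

theorem vertex_add_ne_zero {a b : Fin 4} (hab : a ≠ b) : vertex k a + vertex k b ≠ 0 := by
  obtain ⟨j, e, h⟩ := exists_vertexSign_add_eq_single a b hab
  rw [vertex_add_eq_single h]
  intro h0
  have := congrFun h0 j
  rw [Pi.smul_apply, Pi.single_eq_same, smul_eq_mul] at this
  exact mul_ne_zero two_ne_zero (units_cast_ne_zero e) this

theorem edge_pair_ne_zero {a b : Fin 4} (hab : a ≠ b) (z : Fin 3 → k) :
    ((vertex k a + vertex k b, z) : (Fin 3 → k) × (Fin 3 → k)) ≠ 0 := fun h =>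
  vertex_add_ne_zero hab (congrArg Prod.fst h)

theorem mem_sing₁_iff_edge {P : ℙ k (KIdx → k)} :
    P ∈ sing₁ k ↔ ∃ (a b c d : Fin 4) (hab : a ≠ b) (_ : c ≠ d),
      P = point hi (vertex k a + vertex k b, vertex k c + vertex k d) (edge_pair_ne_zero hab _) := by
  rw [mem_sing₁_iff hi]
  constructor
  · rintro ⟨j, l, e, rfl⟩
    obtain ⟨a, b, hab, h1⟩ := exists_single_eq_vertexSign_add j 1
    obtain ⟨c, d, hcd, h2⟩ := exists_single_eq_vertexSign_add l e
    refine ⟨a, b, c, d, hab, hcd, (point_eq_point_iff hi).mpr ⟨2⁻¹, ?_⟩⟩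
    rw [vertex_add_eq_single h1, vertex_add_eq_single h2, Prod.smul_mk, inv_smul_smul₀ two_ne_zero,
      inv_smul_smul₀ two_ne_zero]
    simp
  · rintro ⟨a, b, c, d, hab, hcd, rfl⟩
    obtain ⟨j, e, h1⟩ := exists_vertexSign_add_eq_single a b hab
    obtain ⟨l, e', h2⟩ := exists_vertexSign_add_eq_single c d hcd
    refine ⟨j, l, e * e', (point_eq_point_iff hi).mpr ⟨2 * (e : ℤ), ?_⟩⟩
    have hs : ∀ (j : Fin 3) (a b : k), a • (Pi.single j b : Fin 3 → k) = Pi.single j (a * b) :=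
      fun j a b => by rw [← Pi.single_smul, smul_eq_mul]
    rw [vertex_add_eq_single h1, vertex_add_eq_single h2, Prod.smul_mk, hs, hs, hs, hs, mul_one]
    congr 2
    have := units_cast_sq (k := k) e
    simp only [Units.val_mul, Int.cast_mul]
    linear_combination 2 * ((e' : ℤ) : k) * this

theorem mem_singularPoints_of_finrank [Infinite k] {p : (Fin 3 → k) × (Fin 3 → k)} (hp : p ≠ 0)
    (hs : ∃ s, p ∈ graphPlane k s)
    (h : ∀ T : Submodule k ((Fin 3 → k) × (Fin 3 → k)),
      (∀ s, p ∈ graphPlane k s → graphPlane k s ≤ T) → 5 ≤ Module.finrank k T) :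
    point hi p hp ∈ singularPoints 3 (humbertComplex i) := by
  obtain ⟨s, hs⟩ := hs
  refine ⟨(point_mem_humbertComplex_iff hi hp).mpr (humbertEqs_of_mem_graphPlane hs), ?_⟩
  rw [finrank_coneTangentSpace hi]
  exact h _ fun s hs => graphPlane_le_comap_coneTangentSpace hi hp hs

theorem singularPoints_humbertComplex (hi : i ^ 2 = -1) [Infinite k] :
    singularPoints 3 (humbertComplex i) = sing₁ k ∪ sing₂ i := by
  have hi0 := ne_zero_of_sq_eq_neg_one hi
  apply Set.Subset.antisymm
  · intro P hP
    obtain ⟨⟨x, z⟩, hq, c, rfl, ⟨hsq, hcub⟩, hx, hz⟩ := cofactors_eq_smul_of_singular hi hP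
    dsimp only at hsq hcub hx hz
    have hx0 : x 1 * x 2 = c * x 0 := congrFun hx 0
    have hx1 : x 0 * x 2 = c * x 1 := congrFun hx 1
    have hx2 : x 0 * x 1 = c * x 2 := congrFun hx 2
    have hz0 : z 1 * z 2 = c * z 0 := congrFun hz 0
    have hz1 : z 0 * z 2 = c * z 1 := congrFun hz 1
    have hz2 : z 0 * z 1 = c * z 2 := congrFun hz 2
    -- If c = 0, all products of two coordinates of x vanish, and likewise for z, so each has at
    -- most one nonzero coordinate. If c ≠ 0, then c xⱼ² = x₀x₁x₂ = z₀z₁z₂ = c zⱼ², so all squares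
    -- agree.
    by_cases hc : c = 0
    · left
      subst hc
      have hsingle : ∀ x : Fin 3 → k, x 1 * x 2 = 0 → x 0 * x 2 = 0 → x 0 * x 1 = 0 →
          ∃ j, x = Pi.single j (x j) := by
        intro x h0 h1 h2
        by_cases hx0 : x 0 = 0
        · rcases mul_eq_zero.mp h0 with h | h
          · exact ⟨2, by ext l; fin_cases l <;> simp [hx0, h]⟩
          · exact ⟨1, by ext l; fin_cases l <;> simp [hx0, h]⟩
        · exact ⟨0, by
            ext l
            fin_cases l <;> simp [(mul_eq_zero.mp h1).resolve_left hx0,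
              (mul_eq_zero.mp h2).resolve_left hx0]⟩
      have hnorm : ∀ (j : Fin 3) (c : k), (Pi.single j c : Fin 3 → k) 0 ^ 2 +
          (Pi.single j c : Fin 3 → k) 1 ^ 2 + (Pi.single j c : Fin 3 → k) 2 ^ 2 = c ^ 2 := by
        intro j c
        fin_cases j <;> simp
      obtain ⟨j, hj⟩ := hsingle x (by simpa using hx0) (by simpa using hx1) (by simpa using hx2)
      obtain ⟨l, hl⟩ := hsingle z (by simpa using hz0) (by simpa using hz1) (by simpa using hz2)
      rw [hj, hl, hnorm, hnorm] at hsq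
      have hxj : x j ≠ 0 := by
        intro h
        rw [h, zero_pow two_ne_zero, eq_comm, sq_eq_zero_iff] at hsq
        apply hq
        rw [hj, hl, h, hsq]
        simp
      obtain ⟨e, he⟩ := exists_units_of_sq_eq_one (c := z l / x j) (by
        rw [div_pow, ← hsq, div_self (pow_ne_zero _ hxj)])
      refine (mem_sing₁_iff hi).mpr ⟨j, l, e, (point_eq_point_iff hi).mpr ⟨x j, ?_⟩⟩
      rw [Prod.smul_mk, ← Pi.single_smul, ← Pi.single_smul, he, smul_eq_mul, smul_eq_mul, mul_one,
        mul_div_cancel₀ _ hxj, ← hj, ← hl]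
    · right
      have hcx : ∀ j, x j ^ 2 = x 0 ^ 2 := by
        intro j
        apply mul_left_cancel₀ hc
        fin_cases j
        · rfl
        · dsimp; linear_combination x 0 * hx0 - x 1 * hx1
        · dsimp; linear_combination x 0 * hx0 - x 2 * hx2
      have hcz : ∀ j, z j ^ 2 = x 0 ^ 2 := by
        intro j
        apply mul_left_cancel₀ hc
        fin_cases j
        · dsimp; linear_combination x 0 * hx0 - z 0 * hz0 - hcub
        · dsimp; linear_combination x 0 * hx0 - z 1 * hz1 - hcub
        · dsimp; linear_combination x 0 * hx0 - z 2 * hz2 - hcub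
      have hxx : x 0 ≠ 0 := by
        intro h
        apply hq
        simp only [h, zero_pow two_ne_zero, sq_eq_zero_iff] at hcx hcz
        ext j
        · exact hcx j
        · exact hcz j
      -- Scaling by i / x₀ turns the x-part into square roots of -1 and the y-part -i z into z / x₀,
      -- with entries ±1.
      refine ⟨(i / x 0) • x, (x 0)⁻¹ • z, fun j => ?_, fun j => ?_, ?_, ?_⟩
      · rw [Pi.smul_apply, smul_eq_mul, mul_pow, hcx, ← mul_pow, div_mul_cancel₀ _ hxx, hi]
      · rw [Pi.smul_apply, smul_eq_mul, mul_pow, hcz, ← mul_pow, inv_mul_cancel₀ hxx, one_pow]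
      · simp only [Pi.smul_apply, smul_eq_mul]
        field_simp
        linear_combination i * x 0 * x 1 * x 2 * hi - i * hcub
      · rw [point_submodule, ← Submodule.span_singleton_smul_eq
          (isUnit_iff_ne_zero.mpr (div_ne_zero hi0 hxx))]
        congr 2
        ext (j | j)
        · rfl
        · simp only [Sum.elim_inr, Pi.smul_apply, smul_eq_mul, kvec_inr]
          field_simp
          linear_combination -z j * hi
  · rintro P (hP | hP)
    · obtain ⟨a, b, c, d, hab, hcd, rfl⟩ := (mem_sing₁_iff_edge hi).mp hP
      refine mem_singularPoints_of_finrank hi _ ?_ fun T hT => five_le_finrank_edge hab hcd hT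
      obtain ⟨s, rfl, rfl⟩ : ∃ s : Perm (Fin 4), s a = c ∧ s b = d :=
        exists_perm_map_pair a c b d hab hcd
      exact ⟨s, (graphPlane k s).add_mem (vertex_pair_mem_graphPlane a)
        (vertex_pair_mem_graphPlane b)⟩
    · obtain ⟨a, b, rfl⟩ := (mem_sing₂_iff hi).mp hP
      refine mem_singularPoints_of_finrank hi _ ⟨swap a b, ?_⟩ fun T hT =>
        five_le_finrank_vertex a b hT
      have := vertex_pair_mem_graphPlane (k := k) (s := swap a b) a
      rwa [swap_apply_left] at this

theorem ncard_sing₁ (hi : i ^ 2 = -1) : (sing₁ k).ncard = 18 := by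
  have : sing₁ k = Set.range fun t : Fin 3 × Fin 3 × ℤˣ => point hi
      (Pi.single t.1 1, Pi.single t.2.1 ((t.2.2 : ℤ) : k)) (single_pair_ne_zero t.1 _) := by
    ext P
    rw [mem_sing₁_iff hi]
    constructor
    · rintro ⟨j, l, e, rfl⟩
      exact ⟨(j, l, e), rfl⟩
    · rintro ⟨⟨j, l, e⟩, rfl⟩
      exact ⟨j, l, e, rfl⟩
  rw [this, ← Set.image_univ, Set.ncard_image_of_injective, Set.ncard_univ]
  · simp
  · rintro ⟨j, l, e⟩ ⟨j', l', e'⟩ h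
    obtain ⟨c, hc⟩ := (point_eq_point_iff hi).mp h
    simp only [Prod.smul_mk, Prod.mk.injEq, ← Pi.single_smul, smul_eq_mul, mul_one] at hc
    obtain ⟨h1, h2⟩ := hc
    have hj : j = j' := by
      by_contra hj
      simpa [Pi.single_eq_of_ne hj] using congrFun h1 j
    subst hj
    have hc : c = 1 := Pi.single_injective j h1
    have hl : l = l' := by
      by_contra hl
      have := congrFun h2 l
      rw [Pi.single_eq_of_ne hl, Pi.single_eq_same] at this
      exact units_cast_ne_zero e this.symm
    subst hl
    have he := Pi.single_injective l h2
    rw [hc, one_mul] at he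
    have : e = e' := by
      have hne : (1 : k) ≠ -1 := fun h => two_ne_zero (α := k) (by linear_combination h)
      rcases Int.units_eq_one_or e with rfl | rfl <;> rcases Int.units_eq_one_or e' with rfl | rfl
      · rfl
      · exact absurd (by simpa using he.symm) hne
      · exact absurd (by simpa using he) hne
      · rfl
    rw [this]

theorem ncard_sing₂ (hi : i ^ 2 = -1) : (sing₂ i).ncard = 16 := by
  have : sing₂ i = Set.range fun t : Fin 4 × Fin 4 =>
      point hi (vertex k t.1, vertex k t.2) (vertex_pair_ne_zero t.1 t.2) := by
    ext P
    rw [mem_sing₂_iff hi]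
    constructor
    · rintro ⟨a, b, rfl⟩
      exact ⟨(a, b), rfl⟩
    · rintro ⟨⟨a, b⟩, rfl⟩
      exact ⟨a, b, rfl⟩
  rw [this, ← Set.image_univ, Set.ncard_image_of_injective, Set.ncard_univ]
  · simp
  · rintro ⟨a, b⟩ ⟨a', b'⟩ h
    obtain ⟨c, hc⟩ := (point_eq_point_iff hi).mp h
    obtain ⟨h1, h2⟩ := Prod.ext_iff.mp hc
    exact Prod.ext (vertex_eq_smul h1.symm) (vertex_eq_smul h2.symm)

theorem ncard_planesIn (hi : i ^ 2 = -1) [Infinite k] : (planesIn (humbertComplex i)).ncard = 24 := by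
  rw [planesIn_humbertComplex hi, ← Set.image_univ,
    Set.ncard_image_of_injective _ (planeSet_injective hi), Set.ncard_univ, Nat.card_perm]
  simp [Nat.factorial]

end SingularSets

/-! ### The structure of the automorphism group and its orbits -/

section Automorphisms

open Equiv

variable {k : Type*} [Field k]

/-- The homomorphism from the group of order two with a given image of the generator. -/
def involutionHom {H : Type*} [Group H] (h : H) (hh : h * h = 1) : Multiplicative (ZMod 2) →* H where
  toFun z := if z = 1 then 1 else h
  map_one' := by simp
  map_mul' := by
    have h0 : ∀ z : Multiplicative (ZMod 2), z = 1 ∨ z = Multiplicative.ofAdd 1 := by decide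
    have h1 : (Multiplicative.ofAdd 1 : Multiplicative (ZMod 2)) ≠ 1 := by decide
    have h2 : (Multiplicative.ofAdd 1 * Multiplicative.ofAdd 1 : Multiplicative (ZMod 2)) = 1 := by
      decide
    intro a b
    rcases h0 a with rfl | rfl <;> rcases h0 b with rfl | rfl
    · simp
    · rw [one_mul, if_pos rfl, one_mul]
    · rw [mul_one, if_pos rfl, mul_one]
    · rw [h2, if_pos rfl, if_neg h1, hh]

theorem involutionHom_ofAdd_one {H : Type*} [Group H] (h : H) (hh : h * h = 1) :
    involutionHom h hh (Multiplicative.ofAdd 1) = h := by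
  change (if (Multiplicative.ofAdd 1 : Multiplicative (ZMod 2)) = 1 then (1 : H) else h) = h
  exact if_neg (by decide)

/-- The square of the matrix is the scalar -1. -/
theorem mk_g₀_mul_self : Matrix.ProjGenLinGroup.mk (g₀ k) * Matrix.ProjGenLinGroup.mk (g₀ k) = 1 := by
  rw [← map_mul, ← map_one Matrix.ProjGenLinGroup.mk, Matrix.ProjGenLinGroup.mk_eq_mk_iff]
  refine ⟨-1, Units.ext ?_⟩
  change Matrix.fromBlocks 0 (-1) 1 0 * Matrix.fromBlocks 0 (-1) 1 0 *
    Matrix.scalar KIdx (-1 : k) = 1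
  rw [map_neg, map_one, mul_neg_one, Matrix.fromBlocks_multiply, Matrix.fromBlocks_neg]
  simp

theorem orbit_eq_of_transitive {α : Type*} [MulAction PGL(KIdx, k) α] {S : Set α}
    {H : Subgroup PGL(KIdx, k)} (hS : ∀ γ ∈ H, ∀ a ∈ S, γ • a ∈ S)
    (hH : ∀ a ∈ S, ∀ b ∈ S, ∃ γ ∈ H, γ • a = b) {a : α} (ha : a ∈ S) :
    MulAction.orbit H a = S := by
  ext b
  constructor
  · rintro ⟨γ, rfl⟩
    exact hS γ γ.2 a ha
  · intro hb
    obtain ⟨γ, hγ, rfl⟩ := hH a ha b hb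
    exact ⟨⟨γ, hγ⟩, rfl⟩

variable [NeZero (2 : k)]

theorem mk_g₀_conj (n : Perm (Fin 4) × Perm (Fin 4)) :
    Matrix.ProjGenLinGroup.mk (g₀ k) * Matrix.ProjGenLinGroup.mk (tetBlock k n) =
      Matrix.ProjGenLinGroup.mk (tetBlock k n.swap) * Matrix.ProjGenLinGroup.mk (g₀ k) := by
  rw [← map_mul, ← map_mul]
  congr 1
  apply Units.ext
  change Matrix.fromBlocks _ _ _ _ * Matrix.fromBlocks _ _ _ _ =
    Matrix.fromBlocks _ _ _ _ * Matrix.fromBlocks _ _ _ _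
  simp [Matrix.fromBlocks_multiply]

/-- The homomorphism from the abstract group to the projective linear group. -/
def humbertHom (k : Type*) [Field k] [NeZero (2 : k)] :
    (Perm (Fin 4) × Perm (Fin 4)) ⋊[swapAction (Perm (Fin 4))] Multiplicative (ZMod 2) →*
      PGL(KIdx, k) :=
  SemidirectProduct.lift (Matrix.ProjGenLinGroup.mk.comp (tetBlock k))
    (involutionHom (Matrix.ProjGenLinGroup.mk (g₀ k)) mk_g₀_mul_self) (by
      have h0 : ∀ z : Multiplicative (ZMod 2), z = 1 ∨ z = Multiplicative.ofAdd 1 := by decide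
      intro z
      rcases h0 z with rfl | rfl
      · ext n
        simp
      · ext1 n
        rw [involutionHom_ofAdd_one]
        change Matrix.ProjGenLinGroup.mk (tetBlock k n.swap) =
          Matrix.ProjGenLinGroup.mk (g₀ k) * Matrix.ProjGenLinGroup.mk (tetBlock k n) *
            (Matrix.ProjGenLinGroup.mk (g₀ k))⁻¹
        rw [mk_g₀_conj, mul_inv_cancel_right])

theorem humbertHom_inl (n : Perm (Fin 4) × Perm (Fin 4)) :
    humbertHom k (SemidirectProduct.inl n) = Matrix.ProjGenLinGroup.mk (tetBlock k n) :=
  SemidirectProduct.lift_inl _ _ _ n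

theorem humbertHom_inr :
    humbertHom k (SemidirectProduct.inr (Multiplicative.ofAdd 1)) =
      Matrix.ProjGenLinGroup.mk (g₀ k) :=
  (SemidirectProduct.lift_inr _ _ _ _).trans (involutionHom_ofAdd_one _ _)

theorem eq_inl_or_eq_inl_mul_inr
    (a : (Perm (Fin 4) × Perm (Fin 4)) ⋊[swapAction (Perm (Fin 4))] Multiplicative (ZMod 2)) :
    ∃ n, a = SemidirectProduct.inl n ∨
      a = SemidirectProduct.inl n * SemidirectProduct.inr (Multiplicative.ofAdd 1) := by
  have h0 : ∀ z : Multiplicative (ZMod 2), z = 1 ∨ z = Multiplicative.ofAdd 1 := by decide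
  refine ⟨a.left, ?_⟩
  conv => congr <;> rw [← SemidirectProduct.inl_left_mul_inr_right a]
  rcases h0 a.right with h | h
  · left; simp [h]
  · right; simp [h]

variable {i : k}

theorem tetProd_humbertEqs {s t : Perm (Fin 4)} {p : (Fin 3 → k) × (Fin 3 → k)}
    (hp : HumbertEqs p) : HumbertEqs (tetProd k s t p) := by
  have key : ∀ (s : Perm (Fin 4)) (x : Fin 3 → k), HumbertEqs (x, (tet k s).mulVec x) :=
    fun s x => humbertEqs_of_mem_graphPlane (mem_graphPlane.mpr rfl)
  obtain ⟨h1, h2⟩ := key s p.1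
  obtain ⟨h3, h4⟩ := key t p.2
  exact ⟨h1.symm.trans (hp.1.trans h3), h2.symm.trans (hp.2.trans h4)⟩

theorem mk_mem_projectiveAut_of_humbertEqs (hi : i ^ 2 = -1) {g : GL KIdx k}
    (h : ∀ p, HumbertEqs p → HumbertEqs (pairMap hi g p))
    (h' : ∀ p, HumbertEqs p → HumbertEqs (pairMap hi g⁻¹ p)) :
    Matrix.ProjGenLinGroup.mk g ∈ projectiveAut (humbertComplex i) := by
  refine (mk_mem_projectiveAut_iff hi).mpr fun p => ⟨fun hp => ?_, h p⟩
  have := h' _ hp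
  rwa [← pairMap_mul, inv_mul_cancel, pairMap_one] at this

theorem mk_tetBlock_mem (hi : i ^ 2 = -1) (n : Perm (Fin 4) × Perm (Fin 4)) :
    Matrix.ProjGenLinGroup.mk (tetBlock k n) ∈ projectiveAut (humbertComplex i) := by
  refine mk_mem_projectiveAut_of_humbertEqs hi (fun p hp => ?_) fun p hp => ?_
  · rw [pairMap_tetBlock]
    exact tetProd_humbertEqs hp
  · rw [← map_inv, pairMap_tetBlock]
    exact tetProd_humbertEqs hp

theorem mk_g₀_mem (hi : i ^ 2 = -1) :
    Matrix.ProjGenLinGroup.mk (g₀ k) ∈ projectiveAut (humbertComplex i) := by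
  rw [mk_mem_projectiveAut_iff hi]
  have hswap : ∀ {p : (Fin 3 → k) × (Fin 3 → k)}, HumbertEqs p → HumbertEqs p.swap :=
    fun h => ⟨h.1.symm, h.2.symm⟩
  intro p
  rw [pairMap_g₀]
  refine ⟨fun h => ?_, fun h => (hswap h).smul i⟩
  have := hswap (h.smul i⁻¹)
  rwa [inv_smul_smul₀ (ne_zero_of_sq_eq_neg_one hi), Prod.swap_swap] at this

theorem humbertHom_mem (hi : i ^ 2 = -1)
    (a : (Perm (Fin 4) × Perm (Fin 4)) ⋊[swapAction (Perm (Fin 4))] Multiplicative (ZMod 2)) :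
    humbertHom k a ∈ projectiveAut (humbertComplex i) := by
  obtain ⟨n, rfl | rfl⟩ := eq_inl_or_eq_inl_mul_inr a
  · rw [humbertHom_inl]
    exact mk_tetBlock_mem hi n
  · rw [map_mul, humbertHom_inl, humbertHom_inr]
    exact mul_mem (mk_tetBlock_mem hi n) (mk_g₀_mem hi)

theorem humbertHom_injective (hi : i ^ 2 = -1) : Function.Injective (humbertHom k) := by
  rw [injective_iff_map_eq_one]
  intro a ha
  obtain ⟨n, rfl | rfl⟩ := eq_inl_or_eq_inl_mul_inr a
  · rw [humbertHom_inl, ← map_one Matrix.ProjGenLinGroup.mk, mk_eq_mk_iff_pairMap hi] at ha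
    obtain ⟨c, hc⟩ := ha
    simp only [pairMap_tetBlock, pairMap_one] at hc
    have h : ∀ a, vertex k (n.1 a) = c • vertex k a ∧ vertex k (n.2 a) = c • vertex k a := by
      intro a
      have := Prod.ext_iff.mp (hc (vertex k a, vertex k a))
      simpa [tetProd_apply] using this
    rw [show n = 1 from Prod.ext (Equiv.ext fun a => vertex_eq_smul (h a).1)
      (Equiv.ext fun a => vertex_eq_smul (h a).2), map_one]
  · exfalso
    rw [map_mul, humbertHom_inl, humbertHom_inr, ← map_mul, ← map_one Matrix.ProjGenLinGroup.mk,
      mk_eq_mk_iff_pairMap hi] at ha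
    obtain ⟨c, hc⟩ := ha
    simp only [pairMap_mul, pairMap_tetBlock, pairMap_one, pairMap_g₀] at hc
    -- An element exchanging the two coordinate spaces moves (v₀, 0) into the second one, so it is
    -- not a scalar.
    obtain ⟨h1, h2⟩ := Prod.ext_iff.mp (hc (vertex k 0, 0))
    simp only [tetProd_apply, Prod.swap_prod_mk, Prod.smul_mk, smul_zero, Matrix.mulVec_zero,
      Matrix.mulVec_smul, tet_mulVec_vertex] at h1 h2
    exact smul_ne_zero (ne_zero_of_sq_eq_neg_one hi) (vertex_ne_zero _) h2

theorem exists_humbertHom_eq [Infinite k] (hi : i ^ 2 = -1) {γ : PGL(KIdx, k)}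
    (hγ : γ ∈ projectiveAut (humbertComplex i)) : ∃ a, humbertHom k a = γ := by
  obtain ⟨g, rfl⟩ := Matrix.ProjGenLinGroup.mk_surjective γ
  have hi0 := ne_zero_of_sq_eq_neg_one hi
  obtain ⟨c, s, t, h | h⟩ := exists_pairMap_eq hi hγ
  · refine ⟨SemidirectProduct.inl (s, t), ?_⟩
    rw [humbertHom_inl, eq_comm, mk_eq_mk_iff_pairMap hi]
    exact ⟨c, fun p => by rw [h, pairMap_tetBlock]⟩
  · refine ⟨SemidirectProduct.inl (s, t) * SemidirectProduct.inr (Multiplicative.ofAdd 1), ?_⟩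
    rw [map_mul, humbertHom_inl, humbertHom_inr, ← map_mul, eq_comm, mk_eq_mk_iff_pairMap hi]
    -- The factor i⁻¹ compensates for `g₀` being i times the exchange.
    refine ⟨c * i⁻¹, fun p => ?_⟩
    rw [h, pairMap_mul, pairMap_g₀, pairMap_tetBlock, map_smul, mul_smul, inv_smul_smul₀ hi0]

/-- The isomorphism of the abstract group with the automorphism group of the Humbert complex. -/
noncomputable def humbertEquiv [Infinite k] (hi : i ^ 2 = -1) :
    (Perm (Fin 4) × Perm (Fin 4)) ⋊[swapAction (Perm (Fin 4))] Multiplicative (ZMod 2) ≃*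
      projectiveAut (humbertComplex i) :=
  MulEquiv.ofBijective ((humbertHom k).codRestrict _ (humbertHom_mem hi))
    ⟨fun _ _ h => humbertHom_injective hi (congrArg Subtype.val h), fun γ =>
      (exists_humbertHom_eq hi γ.2).imp fun _ ha => Subtype.ext ha⟩

theorem coe_humbertEquiv [Infinite k] (hi : i ^ 2 = -1)
    (a : (Perm (Fin 4) × Perm (Fin 4)) ⋊[swapAction (Perm (Fin 4))] Multiplicative (ZMod 2)) :
    (humbertEquiv hi a : PGL(KIdx, k)) = humbertHom k a := rfl

theorem orderOf_mk_g₀ (hi : i ^ 2 = -1) : orderOf (Matrix.ProjGenLinGroup.mk (g₀ k)) = 2 := by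
  refine orderOf_eq_prime ((sq _).trans mk_g₀_mul_self) fun h => ?_
  rw [← humbertHom_inr] at h
  have h1 := humbertHom_injective hi (h.trans (map_one (humbertHom k)).symm)
  have h2 := SemidirectProduct.inr_injective (h1.trans (map_one SemidirectProduct.inr).symm)
  exact absurd h2 (by decide)

theorem smul_point_of_mem [Infinite k] (hi : i ^ 2 = -1) {γ : PGL(KIdx, k)}
    (hγ : γ ∈ projectiveAut (humbertComplex i)) :
    ∃ s t : Perm (Fin 4),
      (∀ p hp, ∃ hp', γ • point hi p hp = point hi (tetProd k s t p) hp') ∨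
      ∀ p hp, ∃ hp', γ • point hi p hp = point hi (tetProd k s t p.swap) hp' := by
  obtain ⟨g, rfl⟩ := Matrix.ProjGenLinGroup.mk_surjective γ
  obtain ⟨c, s, t, h⟩ := exists_pairMap_eq hi hγ
  have hne : ∀ p, p ≠ 0 → tetProd k s t p ≠ 0 := fun p hp =>
    (map_ne_zero_iff _ (tetProd_injective s t)).mpr hp
  refine ⟨s, t, h.imp (fun h p hp => ⟨hne p hp, ?_⟩) fun h p hp => ⟨hne _ ?_, ?_⟩⟩
  · rw [mk_smul_point, point_eq_point_iff]
    exact ⟨c, (h p).symm⟩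
  · exact fun h0 => hp (Prod.swap_injective h0)
  · rw [mk_smul_point, point_eq_point_iff]
    exact ⟨c, (h p).symm⟩

theorem mk_tetBlock_smul_point (hi : i ^ 2 = -1) (s t : Perm (Fin 4))
    {p : (Fin 3 → k) × (Fin 3 → k)} (hp : p ≠ 0) (hp' : tetProd k s t p ≠ 0) :
    Matrix.ProjGenLinGroup.mk (tetBlock k (s, t)) • point hi p hp =
      point hi (tetProd k s t p) hp' := by
  rw [mk_smul_point, point_eq_point_iff]
  exact ⟨1, by rw [pairMap_tetBlock, one_smul]⟩

/-- Edges of the tetrahedron go to edges, and 𝔖₄ is transitive on ordered pairs of distinct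
vertices, independently in the two factors. -/
theorem orbit_sing₁ [Infinite k] (hi : i ^ 2 = -1) {P : ℙ k (KIdx → k)} (hP : P ∈ sing₁ k) :
    MulAction.orbit (projectiveAut (humbertComplex i)) P = sing₁ k := by
  refine orbit_eq_of_transitive (fun γ hγ P hP => ?_) (fun P hP Q hQ => ?_) hP
  · obtain ⟨a, b, c, d, hab, hcd, rfl⟩ := (mem_sing₁_iff_edge hi).mp hP
    obtain ⟨s, t, h | h⟩ := smul_point_of_mem hi hγ
    · obtain ⟨hp', h⟩ := h _ (edge_pair_ne_zero hab _)
      refine (mem_sing₁_iff_edge hi).mpr ⟨s a, s b, t c, t d, s.injective.ne hab,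
        t.injective.ne hcd, ?_⟩
      rw [h]
      congr 1
      simp [tetProd_apply, Matrix.mulVec_add]
    · obtain ⟨hp', h⟩ := h _ (edge_pair_ne_zero hab _)
      refine (mem_sing₁_iff_edge hi).mpr ⟨s c, s d, t a, t b, s.injective.ne hcd,
        t.injective.ne hab, ?_⟩
      rw [h]
      congr 1
      simp [tetProd_apply, Matrix.mulVec_add]
  · obtain ⟨a, b, c, d, hab, hcd, rfl⟩ := (mem_sing₁_iff_edge hi).mp hP
    obtain ⟨a', b', c', d', hab', hcd', rfl⟩ := (mem_sing₁_iff_edge hi).mp hQ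
    obtain ⟨s, rfl, rfl⟩ := exists_perm_map_pair a a' b b' hab hab'
    obtain ⟨t, rfl, rfl⟩ := exists_perm_map_pair c c' d d' hcd hcd'
    refine ⟨_, mk_tetBlock_mem hi (s, t), ?_⟩
    have h : tetProd k s t (vertex k a + vertex k b, vertex k c + vertex k d) =
        (vertex k (s a) + vertex k (s b), vertex k (t c) + vertex k (t d)) := by
      simp [tetProd_apply, Matrix.mulVec_add]
    rw [mk_tetBlock_smul_point hi s t _ (by rw [h]; exact edge_pair_ne_zero hab' _)]
    congr 1

theorem orbit_sing₂ [Infinite k] (hi : i ^ 2 = -1) {P : ℙ k (KIdx → k)} (hP : P ∈ sing₂ i) :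
    MulAction.orbit (projectiveAut (humbertComplex i)) P = sing₂ i := by
  refine orbit_eq_of_transitive (fun γ hγ P hP => ?_) (fun P hP Q hQ => ?_) hP
  · obtain ⟨a, b, rfl⟩ := (mem_sing₂_iff hi).mp hP
    obtain ⟨s, t, h | h⟩ := smul_point_of_mem hi hγ
    · obtain ⟨hp', h⟩ := h _ (vertex_pair_ne_zero a b)
      refine (mem_sing₂_iff hi).mpr ⟨s a, t b, ?_⟩
      rw [h]
      congr 1
      simp [tetProd_apply]
    · obtain ⟨hp', h⟩ := h _ (vertex_pair_ne_zero a b)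
      refine (mem_sing₂_iff hi).mpr ⟨s b, t a, ?_⟩
      rw [h]
      congr 1
      simp [tetProd_apply]
  · obtain ⟨a, b, rfl⟩ := (mem_sing₂_iff hi).mp hP
    obtain ⟨a', b', rfl⟩ := (mem_sing₂_iff hi).mp hQ
    refine ⟨_, mk_tetBlock_mem hi (swap a a', swap b b'), ?_⟩
    have h : tetProd k (swap a a') (swap b b') (vertex k a, vertex k b) =
        (vertex k a', vertex k b') := by
      simp [tetProd_apply]
    rw [mk_tetBlock_smul_point hi _ _ _ (by rw [h]; exact vertex_pair_ne_zero _ _)]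
    congr 1

theorem orbit_planesIn [Infinite k] (hi : i ^ 2 = -1) {E : Set (ℙ k (KIdx → k))}
    (hE : E ∈ planesIn (humbertComplex i)) :
    MulAction.orbit (projectiveAut (humbertComplex i)) E = planesIn (humbertComplex i) := by
  refine orbit_eq_of_transitive (fun γ hγ E hE => ?_) (fun E hE F hF => ?_) hE
  · rw [planesIn_humbertComplex hi] at hE ⊢
    obtain ⟨s, rfl⟩ := hE
    obtain ⟨g, rfl⟩ := Matrix.ProjGenLinGroup.mk_surjective γ
    obtain ⟨t, ht⟩ := exists_map_graphPlane_eq hi hγ s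
    exact ⟨t, (mk_smul_planeSet hi ht).symm⟩
  · rw [planesIn_humbertComplex hi] at hE hF
    obtain ⟨s, rfl⟩ := hE
    obtain ⟨t, rfl⟩ := hF
    -- The pair (1, t s⁻¹) multiplies s on the left by t s⁻¹, so it carries the graph of s to that
    -- of t.
    refine ⟨_, mk_tetBlock_mem hi (1, t * s⁻¹), mk_smul_planeSet hi fun p => ?_⟩
    rw [pairMap_tetBlock]
    constructor
    · intro h
      have := tetProd_mem_graphPlane (s := 1) (t := s * t⁻¹) h
      rw [tetProd_tetProd] at this
      simpa [tetProd_one] using this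
    · intro h
      simpa using tetProd_mem_graphPlane (s := 1) (t := t * s⁻¹) h

end Automorphisms

end Desmic

theorem mainTheorem2 {k : Type*} [Field k] [IsAlgClosed k] (hp : ringChar k ≠ 2)
    (i : k) (hi : i ^ 2 = -1) :
    (∃ φ : (Equiv.Perm (Fin 4) × Equiv.Perm (Fin 4))
          ⋊[Desmic.swapAction (Equiv.Perm (Fin 4))] Multiplicative (ZMod 2) ≃*
          Desmic.projectiveAut (Desmic.humbertComplex i),
        (φ (SemidirectProduct.inr (Multiplicative.ofAdd 1)) : PGL(Desmic.KIdx, k)) =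
          Matrix.ProjGenLinGroup.mk (Desmic.g₀ k) ∧
        Set.range (fun s : Equiv.Perm (Fin 4) × Equiv.Perm (Fin 4) =>
          (φ (SemidirectProduct.inl s) : PGL(Desmic.KIdx, k))) = Desmic.obviousSymmetries k) ∧
      orderOf (Matrix.ProjGenLinGroup.mk (Desmic.g₀ k)) = 2 ∧
      Desmic.singularPoints 3 (Desmic.humbertComplex i) = Desmic.sing₁ k ∪ Desmic.sing₂ i ∧
      Disjoint (Desmic.sing₁ k) (Desmic.sing₂ i) ∧
      (Desmic.sing₁ k).ncard = 18 ∧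
      (Desmic.sing₂ i).ncard = 16 ∧
      (∀ P ∈ Desmic.sing₁ k,
        MulAction.orbit (Desmic.projectiveAut (Desmic.humbertComplex i)) P = Desmic.sing₁ k) ∧
      (∀ P ∈ Desmic.sing₂ i,
        MulAction.orbit (Desmic.projectiveAut (Desmic.humbertComplex i)) P = Desmic.sing₂ i) ∧
      (Desmic.planesIn (Desmic.humbertComplex i)).ncard = 24 ∧
      (∀ E ∈ Desmic.planesIn (Desmic.humbertComplex i),
        MulAction.orbit (Desmic.projectiveAut (Desmic.humbertComplex i)) E =
          Desmic.planesIn (Desmic.humbertComplex i)) := by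
  have : NeZero (2 : k) := ⟨Ring.two_ne_zero hp⟩
  have : Infinite k := IsAlgClosed.instInfinite
  refine ⟨⟨Desmic.humbertEquiv hi, ?_, ?_⟩, Desmic.orderOf_mk_g₀ hi,
    Desmic.singularPoints_humbertComplex hi, Desmic.disjoint_sing hi, Desmic.ncard_sing₁ hi,
    Desmic.ncard_sing₂ hi, fun P hP => Desmic.orbit_sing₁ hi hP,
    fun P hP => Desmic.orbit_sing₂ hi hP, Desmic.ncard_planesIn hi,
    fun E hE => Desmic.orbit_planesIn hi hE⟩
  · rw [Desmic.coe_humbertEquiv, Desmic.humbertHom_inr]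
  · simp only [Desmic.coe_humbertEquiv, Desmic.humbertHom_inl]
    exact Desmic.range_mk_tetBlock
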